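/- Let $d\ge 1$ be an integer and let $\Omega,\mathcal W\subset\mathbb R^d$ be compact. For $r>0$ let $P_{r\Omega}f=\mathbb 1_{r\Omega}f$ and $P_{\mathcal W}f=\mathcal F^{-1}\mathbb 1_{\mathcal W}\mathcal F f$ on the complex Hilbert space $L^2(\mathbb R^d)$, where $\mathcal F$ is the unitary Fourier transform $\mathcal Ff(\xi)=(2\pi)^{-d/2}\int_{\mathbb R^d}e^{-i\langle x,\xi\rangle}f(x)\,dx$, and let $P^{(r)}_{LPS}=P_{r\Omega}P_{\mathcal W}P_{r\Omega}$ be the Landau-Pollak-Slepian operator. For a compact operator $T$ on $L^2(\mathbb R^d)$ and $\varepsilon>0$, let $H(\varepsilon;T)=\log_2 N(\varepsilon;T)$, where $N(\varepsilon;T)$ is the smallest number of closed balls of radius $\varepsilon$ in $L^2(\mathbb R^d)$ (with arbitrary centers) needed to cover the closure of the image under $T$ of the closed unit ball. Then $P^{(r)}_{LPS}$ is compact for every $r>0$, and $$\lim_{r\to\infty}\frac{H\big(\varepsilon;P^{(r)}_{LPS}\big)}{r^d}=\frac{2\,\mathcal H^d(\Omega)\,\mathcal H^d(\mathcal W)}{(2\pi)^d}\,\log_2\big(\varepsilon^{-1}\big)\qquad\text{for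 all }\varepsilon\in(0,1],$$ where $\mathcal H^d$ is the $d$-dimensional Hausdorff measure, normalized so as to agree with Lebesgue measure on $\mathbb R^d$. -/

import Mathlib

open MeasureTheory FourierTransform Filter Topology
open scoped Pointwise NNReal ENNReal

noncomputable section

/-- The metric entropy `H(ε; K)`: the logarithm to base `2` of the minimal number of closed balls
of radius `ε`, with centres anywhere in the ambient space, that are needed to cover `K`. -/
def metricEntropy {X : Type*} [PseudoMetricSpace X] (ε : ℝ) (K : Set X) : ℝ :=
  Real.logb 2 ((Metric.externalCoveringNumber ε.toNNReal K).toNat : ℝ)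

/-- The entropy `H(ε; T)` of a (compact) operator `T`: the metric entropy of the closure of the
image under `T` of the closed unit ball. -/
def operatorEntropy {𝕜 E F : Type*} [NontriviallyNormedField 𝕜]
    [SeminormedAddCommGroup E] [NormedSpace 𝕜 E] [SeminormedAddCommGroup F] [NormedSpace 𝕜 F]
    (ε : ℝ) (T : E →L[𝕜] F) : ℝ :=
  metricEntropy ε (closure (T '' Metric.closedBall 0 1))

/-- The complex Hilbert space `L²(ℝᵈ)`. -/
abbrev L2Space (d : ℕ) : Type := Lp ℂ 2 (volume : Measure (EuclideanSpace ℝ (Fin d)))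

/-- Multiplication by the indicator function of a measurable set `S`, as a bounded operator
on `L²(ℝᵈ)`. -/
def indicatorProj {d : ℕ} (S : Set (EuclideanSpace ℝ (Fin d))) (hS : MeasurableSet S) :
    L2Space d →L[ℂ] L2Space d :=
  LinearMap.mkContinuous
    { toFun := fun f => ((Lp.memLp f).indicator hS).toLp (S.indicator f)
      map_add' := by
        intro f g
        apply Lp.ext
        filter_upwards [((Lp.memLp (f + g)).indicator hS).coeFn_toLp,
          ((Lp.memLp f).indicator hS).coeFn_toLp, ((Lp.memLp g).indicator hS).coeFn_toLp,
          Lp.coeFn_add f g,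
          Lp.coeFn_add (((Lp.memLp f).indicator hS).toLp (S.indicator f))
            (((Lp.memLp g).indicator hS).toLp (S.indicator g))] with x h1 h2 h3 h4 h5
        rw [h1, h5, Pi.add_apply, h2, h3]
        by_cases hx : x ∈ S
        · simp only [Set.indicator_of_mem hx]
          exact h4
        · simp [hx]
      map_smul' := by
        intro c f
        apply Lp.ext
        filter_upwards [((Lp.memLp (c • f)).indicator hS).coeFn_toLp,
          ((Lp.memLp f).indicator hS).coeFn_toLp, Lp.coeFn_smul c f,
          Lp.coeFn_smul c (((Lp.memLp f).indicator hS).toLp (S.indicator f))] with x h1 h2 h3 h4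
        rw [h1, RingHom.id_apply, h4, Pi.smul_apply, h2]
        by_cases hx : x ∈ S <;> simp [hx, h3] }
    1
    (by
      intro f
      rw [one_mul]
      apply Lp.norm_le_norm_of_ae_le
      filter_upwards [((Lp.memLp f).indicator hS).coeFn_toLp] with x h1
      change ‖(((Lp.memLp f).indicator hS).toLp (S.indicator f)) x‖ ≤ ‖f x‖
      rw [h1]
      exact norm_indicator_le_norm_self _ _)

/-- The band-limiting projection `f ↦ 𝓕⁻¹ 1_S 𝓕 f` on `L²(ℝᵈ)`, for Mathlib's unitary Fourier
transform `𝓕 f (ν) = ∫ exp (-2πi ⟨x, ν⟩) f x dx`; thus `S` is a set of ordinary frequencies. -/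
def bandProj {d : ℕ} (S : Set (EuclideanSpace ℝ (Fin d))) (hS : MeasurableSet S) :
    L2Space d →L[ℂ] L2Space d :=
  let 𝓕₂ := Lp.fourierTransformₗᵢ (EuclideanSpace ℝ (Fin d)) ℂ
  (𝓕₂.symm.toContinuousLinearEquiv : L2Space d →L[ℂ] L2Space d) ∘L indicatorProj S hS ∘L
    (𝓕₂.toContinuousLinearEquiv : L2Space d →L[ℂ] L2Space d)

/-- The ordinary frequencies `ν` whose angular frequency `ξ = 2πν` lies in `W`. -/
def ordinaryFrequencies {d : ℕ} (W : Set (EuclideanSpace ℝ (Fin d))) :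
    Set (EuclideanSpace ℝ (Fin d)) :=
  {ν | (2 * Real.pi) • ν ∈ W}

theorem measurableSet_ordinaryFrequencies {d : ℕ} {W : Set (EuclideanSpace ℝ (Fin d))}
    (hW : MeasurableSet W) : MeasurableSet (ordinaryFrequencies W) :=
  (measurable_const_smul (2 * Real.pi)) hW

/-- The Landau-Pollak-Slepian operator `P_{rΩ} P_W P_{rΩ}` on `L²(ℝᵈ)`. Here `W` is a set of
angular frequencies, i.e. `P_W f = 𝓕⁻¹ 1_W 𝓕 f` with `𝓕 f (ξ) = (2π)^(-d/2) ∫ exp (-i ⟨x, ξ⟩) f x dx`;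
since this transform at `ξ = 2πν` is a constant times Mathlib's at `ν`, the projection `P_W` is the
multiplier by the indicator of `{ν | 2πν ∈ W}` for Mathlib's transform. -/
def lpsOperator {d : ℕ} (Ω W : Set (EuclideanSpace ℝ (Fin d)))
    (hΩ : IsCompact Ω) (hW : IsCompact W) (r : ℝ) : L2Space d →L[ℂ] L2Space d :=
  indicatorProj (r • Ω) (hΩ.smul r).measurableSet ∘L
    bandProj (ordinaryFrequencies W) (measurableSet_ordinaryFrequencies hW.measurableSet) ∘L
    indicatorProj (r • Ω) (hΩ.smul r).measurableSet

end

/-! Write `K = r • Ω`, `S = ordinaryFrequencies W`, `P` for `indicatorProj K`, `Q` for `bandProj S`.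
The operator `T = P Q P` is a positive compact contraction, so it is diagonal in a Hilbert basis
with eigenvalues `Λ i` in `[0, 1]`. Its trace is `volume K * volume S = r ^ d * c`, where `c =
volume Ω * volume S`, and `tr (T - T²)` is the squared Hilbert-Schmidt norm of the leakage `(1 - P)
Q P`. Both come from `tsum_enorm_sq_of_inner_repr`. By `tendsto_lintegral_compl_smul_div` the
leakage is `o(r ^ d)`. Since `Λ - Λ²` is small only near `0` and `1`, about `c * r ^ d` eigenvalues
are close to `1`, and only `o(r ^ d)` lie in between (`card_le_of_hasSum`, `le_card_of_hasSum`).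

For entropy purposes the image of the unit ball is therefore a unit ball of complex dimension `N ~ c
* r ^ d`, that is, of real dimension `2 * N`, and its `ε`-entropy should be `2 * N * logb 2 ε⁻¹`.
The lower bound compares volumes (`pow_le_card_mul_pow_of_eigenbasis`). The upper bound needs
coverings with exponential base arbitrarily close to `ε⁻¹`; the usual `(1 + 2 / ε) ^ n` is too weak.
`exists_covering_closedBall` obtains them by choosing centres at random in a ball of radius slightly
above `√(1 - ε²)`. -/

/-! ### The L² Fourier transform as an integral on integrable functions. -/

section FourierL2

variable {V : Type*} [NormedAddCommGroup V] [InnerProductSpace ℝ V] [FiniteDimensional ℝ V]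
  [MeasurableSpace V] [BorelSpace V]

theorem continuous_fourier_of_integrable {f : V → ℂ} (hf : Integrable f) : Continuous (𝓕 f) :=
  VectorFourier.fourierIntegral_continuous Real.continuous_fourierChar
    (by exact continuous_inner) hf

theorem continuous_fourierInv_of_integrable {f : V → ℂ} (hf : Integrable f) :
    Continuous (𝓕⁻ f) := by
  have : 𝓕⁻ f = fun x => 𝓕 f (-x) := funext fun x => Real.fourierInv_eq_fourier_neg f x
  rw [this]
  exact (continuous_fourier_of_integrable hf).comp continuous_neg

/-- Real smooth compactly supported test functions already separate locally integrable functions,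
and they are Schwartz functions. -/
theorem ae_eq_of_forall_toTemperedDistribution_eq (f : Lp ℂ 2 (volume : Measure V)) {g : V → ℂ}
    (hg : Continuous g)
    (h : ∀ φ : SchwartzMap V ℂ, Lp.toTemperedDistribution f φ = ∫ x, φ x • g x) :
    ∀ᵐ x, f x = g x := by
  apply ae_eq_of_integral_contDiff_smul_eq
  · exact (Lp.memLp f).locallyIntegrable (by norm_num)
  · exact hg.locallyIntegrable
  · intro φ hφ hc
    have hg₁ : HasCompactSupport (Complex.ofRealCLM ∘ φ) := hc.comp_left rfl
    have hg₂ : ContDiff ℝ (⊤ : ℕ∞) (Complex.ofRealCLM ∘ φ) := by fun_prop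
    simpa using h (hg₁.toSchwartzMap hg₂)

/-- The `L²` Fourier transform of an integrable function is given by the Fourier integral. -/
theorem coeFn_fourier_ae_eq (f : Lp ℂ 2 (volume : Measure V)) (hf : Integrable f) :
    ∀ᵐ ξ, (𝓕 f : Lp ℂ 2 (volume : Measure V)) ξ = 𝓕 (f : V → ℂ) ξ := by
  refine ae_eq_of_forall_toTemperedDistribution_eq _ (continuous_fourier_of_integrable hf) ?_
  intro φ
  rw [← Lp.fourier_toTemperedDistribution_eq, TemperedDistribution.fourier_apply,
    Lp.toTemperedDistribution_apply]
  simpa using! VectorFourier.integral_bilin_fourierIntegral_eq_flip (.lsmul ℂ ℂ) (L := innerₗ V)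
    Real.continuous_fourierChar continuous_inner φ.integrable hf

/-- The inverse `L²` Fourier transform of an integrable function is given by the inverse Fourier
integral. -/
theorem coeFn_fourierInv_ae_eq (f : Lp ℂ 2 (volume : Measure V)) (hf : Integrable f) :
    ∀ᵐ x, (𝓕⁻ f : Lp ℂ 2 (volume : Measure V)) x = 𝓕⁻ (f : V → ℂ) x := by
  refine ae_eq_of_forall_toTemperedDistribution_eq _ (continuous_fourierInv_of_integrable hf) ?_
  intro φ
  rw [← Lp.fourierInv_toTemperedDistribution_eq, TemperedDistribution.fourierInv_apply,
    Lp.toTemperedDistribution_apply]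
  have hc : Continuous fun p : V × V => (-innerₗ V) p.1 p.2 := by
    exact (continuous_inner (𝕜 := ℝ) (E := V)).neg
  have h := VectorFourier.integral_bilin_fourierIntegral_eq_flip (.lsmul ℂ ℂ) (L := -innerₗ V)
    (μ := volume) (ν := volume) Real.continuous_fourierChar hc φ.integrable hf
  have hflip : (-innerₗ V).flip = -innerₗ V := by ext x y; simp [real_inner_comm]
  rw [hflip] at h
  rw [SchwartzMap.fourierInv_coe]
  exact h

end FourierL2

/-! ### Truncated plane waves and the band-limiting kernel. -/

section PlaneWaves

variable {d : ℕ}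

local notation "𝔼" => EuclideanSpace ℝ (Fin d)

theorem coeFn_indicatorProj {S : Set 𝔼} (hS : MeasurableSet S) (f : L2Space d) :
    indicatorProj S hS f =ᵐ[volume] S.indicator f :=
  ((Lp.memLp f).indicator hS).coeFn_toLp

theorem integrable_indicatorProj {S : Set 𝔼} (hS : MeasurableSet S) (hfin : volume S ≠ ∞)
    (f : L2Space d) : Integrable (indicatorProj S hS f) := by
  rw [integrable_congr (coeFn_indicatorProj hS f), integrable_indicator_iff hS]
  have : IsFiniteMeasure (volume.restrict S) := ⟨by simpa using hfin.lt_top⟩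
  exact ((Lp.memLp f).restrict S).integrable (by norm_num)

theorem memLp_indicator_fourierChar {S : Set 𝔼} (hS : MeasurableSet S) (hfin : volume S ≠ ∞)
    (x : 𝔼) : MemLp (S.indicator fun ξ => (Real.fourierChar (inner ℝ ξ x) : ℂ)) 2 volume := by
  rw [memLp_indicator_iff_restrict hS]
  have : IsFiniteMeasure (volume.restrict S) := ⟨by simpa using hfin.lt_top⟩
  refine MemLp.of_bound ?_ 1 ?_
  · have : Continuous fun ξ : 𝔼 => (Real.fourierChar (inner ℝ ξ x) : ℂ) := by
      have := Real.continuous_fourierChar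
      fun_prop
    exact this.aestronglyMeasurable
  · exact .of_forall fun ξ => (Circle.norm_coe _).le

/-- The plane wave of frequency `x` restricted to `S`, as an element of `L²`. -/
noncomputable def planeWave (S : Set 𝔼) (hS : MeasurableSet S) (hfin : volume S ≠ ∞) (x : 𝔼) :
    L2Space d :=
  (memLp_indicator_fourierChar hS hfin x).toLp _

theorem coeFn_planeWave {S : Set 𝔼} (hS : MeasurableSet S) (hfin : volume S ≠ ∞) (x : 𝔼) :
    planeWave S hS hfin x =ᵐ[volume]
      S.indicator fun ξ => (Real.fourierChar (inner ℝ ξ x) : ℂ) :=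
  (memLp_indicator_fourierChar hS hfin x).coeFn_toLp

theorem enorm_sq_eq_lintegral (f : L2Space d) : ‖f‖ₑ ^ 2 = ∫⁻ x, ‖f x‖ₑ ^ 2 := by
  rw [Lp.enorm_def, eLpNorm_eq_lintegral_rpow_enorm_toReal (by norm_num) (by norm_num),
    ← ENNReal.rpow_natCast, ← ENNReal.rpow_mul]
  simp

theorem enorm_sq_planeWave {S : Set 𝔼} (hS : MeasurableSet S) (hfin : volume S ≠ ∞) (x : 𝔼) :
    ‖planeWave S hS hfin x‖ₑ ^ 2 = volume S := by
  rw [enorm_sq_eq_lintegral, ← setLIntegral_one S, ← lintegral_indicator hS]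
  refine lintegral_congr_ae ?_
  filter_upwards [coeFn_planeWave hS hfin x] with ξ h
  rw [h]
  by_cases hξ : ξ ∈ S
  · rw [Set.indicator_of_mem hξ, Set.indicator_of_mem hξ, ← ofReal_norm, Circle.norm_coe]
    simp
  · simp [hξ]

/-- After truncation to `S`, evaluation of the transform at a point becomes pairing with a fixed L²
vector. This is the form in which Hilbert-Schmidt norms are computed below. -/
theorem inner_planeWave {S : Set 𝔼} (hS : MeasurableSet S) (hfin : volume S ≠ ∞) (x : 𝔼)
    (f : L2Space d) :
    inner ℂ (planeWave S hS hfin x) f = 𝓕 (indicatorProj S hS f : 𝔼 → ℂ) x := by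
  rw [L2.inner_def, Real.fourier_eq]
  refine integral_congr_ae ?_
  filter_upwards [coeFn_planeWave hS hfin x, coeFn_indicatorProj hS f] with ξ h1 h2
  rw [h1, h2]
  by_cases hξ : ξ ∈ S
  · simp [hξ, Circle.smul_def, Real.fourierChar_apply, ← Complex.exp_conj, map_ofNat, mul_comm]
  · simp [hξ]

theorem coeFn_fourier_indicatorProj {S : Set 𝔼} (hS : MeasurableSet S) (hfin : volume S ≠ ∞)
    (f : L2Space d) :
    ∀ᵐ ξ, (𝓕 (indicatorProj S hS f) : L2Space d) ξ = inner ℂ (planeWave S hS hfin ξ) f := by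
  filter_upwards [coeFn_fourier_ae_eq _ (integrable_indicatorProj hS hfin f)] with ξ h
  rw [h, inner_planeWave]

theorem coeFn_fourierInv_indicatorProj {S : Set 𝔼} (hS : MeasurableSet S) (hfin : volume S ≠ ∞)
    (f : L2Space d) :
    ∀ᵐ x, (𝓕⁻ (indicatorProj S hS f) : L2Space d) x = inner ℂ (planeWave S hS hfin (-x)) f := by
  filter_upwards [coeFn_fourierInv_ae_eq _ (integrable_indicatorProj hS hfin f)] with ξ h
  rw [h, inner_planeWave, Real.fourierInv_eq_fourier_neg]

theorem inner_indicatorProj_left {S : Set 𝔼} (hS : MeasurableSet S) (f g : L2Space d) :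
    inner ℂ (indicatorProj S hS f) g = inner ℂ f (indicatorProj S hS g) := by
  rw [L2.inner_def, L2.inner_def]
  refine integral_congr_ae ?_
  filter_upwards [coeFn_indicatorProj hS f, coeFn_indicatorProj hS g] with ξ h1 h2
  rw [h1, h2]
  by_cases hξ : ξ ∈ S <;> simp [hξ]

theorem indicatorProj_idem {S : Set 𝔼} (hS : MeasurableSet S) (f : L2Space d) :
    indicatorProj S hS (indicatorProj S hS f) = indicatorProj S hS f := by
  apply Lp.ext
  filter_upwards [coeFn_indicatorProj hS (indicatorProj S hS f), coeFn_indicatorProj hS f]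
    with ξ h1 h2
  rw [h1]
  by_cases hξ : ξ ∈ S <;> simp [hξ, h2]

theorem bandProj_apply {S : Set 𝔼} (hS : MeasurableSet S) (f : L2Space d) :
    bandProj S hS f = (𝓕⁻ (indicatorProj S hS (𝓕 f)) : L2Space d) := rfl

theorem inner_fourierInv_left (f g : L2Space d) :
    inner ℂ (𝓕⁻ f : L2Space d) g = inner ℂ f (𝓕 g : L2Space d) := by
  rw [← Lp.inner_fourier_eq, FourierTransform.fourier_fourierInv_eq]

theorem inner_fourierInv_right (f g : L2Space d) :
    inner ℂ f (𝓕⁻ g : L2Space d) = inner ℂ (𝓕 f : L2Space d) g := by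
  rw [← Lp.inner_fourier_eq, FourierTransform.fourier_fourierInv_eq]

/-- The convolution kernel of the band-limiting projection. -/
noncomputable def bandKernel (S : Set 𝔼) : 𝔼 → ℂ :=
  𝓕⁻ (S.indicator fun _ => (1 : ℂ))

theorem coeFn_fourierInv_planeWave {S : Set 𝔼} (hS : MeasurableSet S) (hfin : volume S ≠ ∞)
    (x : 𝔼) :
    ∀ᵐ y, (𝓕⁻ (planeWave S hS hfin (-x)) : L2Space d) y = bandKernel S (y - x) := by
  have hint : Integrable (planeWave S hS hfin (-x)) := by
    rw [integrable_congr (coeFn_planeWave hS hfin (-x)), integrable_indicator_iff hS]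
    have : IsFiniteMeasure (volume.restrict S) := ⟨by simpa using hfin.lt_top⟩
    exact ((memLp_indicator_iff_restrict hS).1
      (memLp_indicator_fourierChar hS hfin (-x))).integrable (by norm_num)
  filter_upwards [coeFn_fourierInv_ae_eq _ hint] with y h
  rw [h, bandKernel, Real.fourierInv_eq, Real.fourierInv_eq]
  refine integral_congr_ae ?_
  filter_upwards [coeFn_planeWave hS hfin (-x)] with ξ h1
  rw [h1]
  by_cases hξ : ξ ∈ S
  · simp only [hξ, Set.indicator_of_mem, Circle.smul_def, smul_eq_mul, mul_one]
    rw [← Circle.coe_mul, ← AddChar.map_add_eq_mul, ← inner_add_right, sub_eq_add_neg]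
  · simp [hξ]

theorem continuous_bandKernel {S : Set 𝔼} (hS : MeasurableSet S) (hfin : volume S ≠ ∞) :
    Continuous (bandKernel S) :=
  continuous_fourierInv_of_integrable
    ((integrable_indicator_iff hS).2 (integrableOn_const hfin))

theorem lintegral_enorm_sq_bandKernel {S : Set 𝔼} (hS : MeasurableSet S) (hfin : volume S ≠ ∞) :
    ∫⁻ z, ‖bandKernel S z‖ₑ ^ 2 = volume S := by
  -- Plancherel; the frequency is written `-0` to match `coeFn_fourierInv_planeWave` at `x = 0`.
  have h : ‖(𝓕⁻ (planeWave S hS hfin (-0)) : L2Space d)‖ₑ ^ 2 = volume S := by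
    rw [← enorm_sq_planeWave hS hfin (-0)]
    congr 1
    exact congrArg ENNReal.ofNNReal (Subtype.ext
      ((Lp.fourierTransformₗᵢ 𝔼 ℂ).symm.norm_map (planeWave S hS hfin (-0))))
  rw [← h, enorm_sq_eq_lintegral]
  refine lintegral_congr_ae ?_
  filter_upwards [coeFn_fourierInv_planeWave hS hfin 0] with y hy
  rw [hy, sub_zero]

end PlaneWaves

/-! ### Parseval identities and Hilbert-Schmidt operators. -/

section HilbertBasisLemmas

variable {𝕜 ι E F : Type*} [RCLike 𝕜] [NormedAddCommGroup E] [InnerProductSpace 𝕜 E]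
  [NormedAddCommGroup F] [InnerProductSpace 𝕜 F]

theorem HilbertBasis.hasSum_norm_inner_sq (b : HilbertBasis ι 𝕜 E) (x : E) :
    HasSum (fun i => ‖inner 𝕜 (b i) x‖ ^ 2) (‖x‖ ^ 2) := by
  have h := (b.hasSum_inner_mul_inner x x).mapL (RCLike.reCLM (K := 𝕜))
  simp only [RCLike.reCLM_apply, inner_self_eq_norm_sq_to_K] at h
  rw [← RCLike.ofReal_pow, RCLike.ofReal_re] at h
  have heq : ∀ i, RCLike.re (inner 𝕜 x (b i) * inner 𝕜 (b i) x) = ‖inner 𝕜 (b i) x‖ ^ 2 := by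
    intro i
    rw [← inner_conj_symm x (b i), RCLike.conj_mul, ← RCLike.ofReal_pow, RCLike.ofReal_re]
  simpa only [heq] using h

theorem HilbertBasis.tsum_enorm_inner_sq (b : HilbertBasis ι 𝕜 E) (x : E) :
    ∑' i, ‖inner 𝕜 (b i) x‖ₑ ^ 2 = ‖x‖ₑ ^ 2 := by
  simp only [← ofReal_norm, ← ENNReal.ofReal_pow (norm_nonneg _)]
  rw [← ENNReal.ofReal_tsum_of_nonneg (fun _ => by positivity)
    (b.hasSum_norm_inner_sq x).summable, (b.hasSum_norm_inner_sq x).tsum_eq]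

/-- Distinct orthonormal vectors are at distance `√2`, so the balls of radius `1 / 2` around them
are disjoint. -/
theorem Orthonormal.countable_of_separableSpace [TopologicalSpace.SeparableSpace E] {v : ι → E}
    (hv : Orthonormal 𝕜 v) : Countable ι := by
  have hd : (Set.univ : Set ι).PairwiseDisjoint fun i => Metric.ball (v i) (1 / 2) := by
    intro i _ j _ hij
    apply Metric.ball_disjoint_ball
    have h1 : ‖v i - v j‖ ^ 2 = 2 := by
      rw [@norm_sub_sq 𝕜, hv.1, hv.1, hv.2 hij]
      norm_num
    rw [dist_eq_norm]
    nlinarith [norm_nonneg (v i - v j)]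
  exact Set.countable_univ_iff.1 (hd.countable_of_isOpen (fun _ _ => Metric.isOpen_ball)
    fun i _ => ⟨v i, Metric.mem_ball_self (by norm_num)⟩)

/-- A Hilbert-Schmidt operator is compact. -/
theorem HilbertBasis.isCompactOperator_of_summable [CompleteSpace F] (b : HilbertBasis ι 𝕜 E)
    (A : E →L[𝕜] F) (hA : Summable fun i => ‖A (b i)‖ ^ 2) : IsCompactOperator A := by
  set S := ∑' i, ‖A (b i)‖ ^ 2
  let B : Finset ι → E →L[𝕜] F := fun s => ∑ i ∈ s, (innerSL 𝕜 (b i)).smulRight (A (b i))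
  have hB : ∀ s x, B s x = ∑ i ∈ s, inner 𝕜 (b i) x • A (b i) := by
    intro s x
    simp [B]
  have hS : ∀ s : Finset ι, ∑ i ∈ s, ‖A (b i)‖ ^ 2 ≤ S :=
    fun s => hA.sum_le_tsum s fun _ _ => by positivity
  -- Cauchy-Schwarz bounds the error of the finite-rank truncation by the tail of the
  -- Hilbert-Schmidt sum, so the truncations converge in operator norm.
  have hnorm : ∀ s, ‖B s - A‖ ≤ √(S - ∑ i ∈ s, ‖A (b i)‖ ^ 2) := by
    intro s
    refine ContinuousLinearMap.opNorm_le_bound _ (Real.sqrt_nonneg _) fun x => ?_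
    have hlim : Tendsto (fun t => ‖B s x - B t x‖) atTop (𝓝 ‖B s x - A x‖) := by
      have h1 : Tendsto (fun t => B t x) atTop (𝓝 (A x)) := by
        have h2 : HasSum (fun i => inner 𝕜 (b i) x • A (b i)) (A x) := by
          have := (b.hasSum_repr x).mapL A
          simpa [b.repr_apply_apply] using this
        simpa [hB] using! h2
      exact (tendsto_const_nhds.sub h1).norm
    refine le_of_tendsto hlim ?_
    filter_upwards [eventually_ge_atTop s] with t hst
    classical
    have h1 : B t x - B s x = ∑ i ∈ t \ s, inner 𝕜 (b i) x • A (b i) := by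
      rw [hB, hB, ← Finset.sum_sdiff hst, add_sub_cancel_right]
    have h2 : ∑ i ∈ t \ s, ‖A (b i)‖ ^ 2 ≤ S - ∑ i ∈ s, ‖A (b i)‖ ^ 2 := by
      have := hS t
      rw [← Finset.sum_sdiff hst] at this
      linarith
    have h3 : ∑ i ∈ t \ s, ‖inner 𝕜 (b i) x‖ ^ 2 ≤ ‖x‖ ^ 2 :=
      sum_le_hasSum _ (fun _ _ => by positivity) (b.hasSum_norm_inner_sq x)
    calc ‖B s x - B t x‖ = ‖∑ i ∈ t \ s, inner 𝕜 (b i) x • A (b i)‖ := by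
          rw [norm_sub_rev, h1]
      _ ≤ ∑ i ∈ t \ s, ‖A (b i)‖ * ‖inner 𝕜 (b i) x‖ :=
          norm_sum_le_of_le _ fun i _ => by rw [norm_smul, mul_comm]
      _ ≤ √(∑ i ∈ t \ s, ‖A (b i)‖ ^ 2) * √(∑ i ∈ t \ s, ‖inner 𝕜 (b i) x‖ ^ 2) :=
          Real.sum_mul_le_sqrt_mul_sqrt _ _ _
      _ ≤ √(S - ∑ i ∈ s, ‖A (b i)‖ ^ 2) * ‖x‖ := by
          gcongr
          exact Real.sqrt_le_iff.2 ⟨norm_nonneg _, h3⟩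
  have hlim : Tendsto B atTop (𝓝 A) := by
    rw [tendsto_iff_norm_sub_tendsto_zero]
    refine squeeze_zero (fun _ => norm_nonneg _) hnorm ?_
    have h1 : Tendsto (fun s => S - ∑ i ∈ s, ‖A (b i)‖ ^ 2) atTop (𝓝 (S - S)) :=
      tendsto_const_nhds.sub hA.hasSum
    simpa using h1.sqrt
  refine isCompactOperator_of_tendsto hlim (Eventually.of_forall fun s => ?_)
  have hrank : ∀ s : Finset ι, IsCompactOperator (B s) := by
    intro s
    have : FiniteDimensional 𝕜 (Submodule.span 𝕜 ((fun i => A (b i)) '' (s : Set ι))) :=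
      FiniteDimensional.span_of_finite 𝕜 (s.finite_toSet.image _)
    have hmem : ∀ x, B s x ∈ Submodule.span 𝕜 ((fun i => A (b i)) '' (s : Set ι)) := by
      intro x
      rw [hB]
      exact Submodule.sum_mem _ fun i hi =>
        Submodule.smul_mem _ _ (Submodule.subset_span ⟨i, hi, rfl⟩)
    have hid : IsCompactOperator
        (id : Submodule.span 𝕜 ((fun i => A (b i)) '' (s : Set ι)) → _) :=
      isCompactOperator_id_iff_finiteDimensional.2 this
    have := (hid.comp_clm ((B s).codRestrict _ hmem)).clm_comp
      (Submodule.span 𝕜 ((fun i => A (b i)) '' (s : Set ι))).subtypeL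
    exact this
  exact hrank s

end HilbertBasisLemmas

/-! ### Traces of the space- and band-limiting operator. -/

section TraceFormulas

variable {d : ℕ} {ι : Type*}

local notation "𝔼" => EuclideanSpace ℝ (Fin d)

/-- Tonelli moves the sum under the integral, where Parseval for `a x` evaluates it. Countability of
`ι` gives one null set that serves all basis vectors. -/
theorem tsum_enorm_sq_of_inner_repr [Countable ι] (b : HilbertBasis ι ℂ (L2Space d))
    {A : L2Space d → L2Space d} {a : 𝔼 → L2Space d}
    (h : ∀ e, ∀ᵐ x, A e x = inner ℂ (a x) e) :
    ∑' i, ‖A (b i)‖ₑ ^ 2 = ∫⁻ x, ‖a x‖ₑ ^ 2 := by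
  simp_rw [enorm_sq_eq_lintegral (A _)]
  rw [← lintegral_tsum fun i => ((Lp.aestronglyMeasurable (A (b i))).enorm.pow_const 2)]
  refine lintegral_congr_ae ?_
  filter_upwards [ae_all_iff.2 fun i => h (b i)] with x hx
  simp_rw [hx]
  rw [← b.tsum_enorm_inner_sq (a x)]
  refine tsum_congr fun i => ?_
  rw [← inner_conj_symm, RCLike.enorm_conj]

/-- The trace of `P_K Q_S P_K`, as the squared Hilbert-Schmidt norm of `1_S 𝓕 P_K`. -/
theorem tsum_enorm_sq_fourier_indicatorProj [Countable ι] (b : HilbertBasis ι ℂ (L2Space d))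
    {K S : Set 𝔼} (hK : MeasurableSet K) (hKfin : volume K ≠ ∞) (hS : MeasurableSet S) :
    ∑' i, ‖indicatorProj S hS (𝓕 (indicatorProj K hK (b i)) : L2Space d)‖ₑ ^ 2
      = volume K * volume S := by
  rw [tsum_enorm_sq_of_inner_repr b
    (A := fun e => indicatorProj S hS (𝓕 (indicatorProj K hK e) : L2Space d))
    (a := S.indicator (planeWave K hK hKfin))]
  · have : ∀ x, ‖S.indicator (planeWave K hK hKfin) x‖ₑ ^ 2
        = S.indicator (fun _ => volume K) x := by
      intro x
      by_cases hx : x ∈ S <;> simp [hx, enorm_sq_planeWave]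
    simp_rw [this]
    rw [lintegral_indicator hS, setLIntegral_const]
  · intro e
    filter_upwards [coeFn_indicatorProj hS (𝓕 (indicatorProj K hK e) : L2Space d),
      coeFn_fourier_indicatorProj hK hKfin e] with x h1 h2
    rw [h1]
    by_cases hx : x ∈ S <;> simp [hx, h2]

/-- The squared Hilbert-Schmidt norm of `(1 - P_K) Q_S P_K`. -/
theorem tsum_enorm_sq_compl_bandProj [Countable ι] (b : HilbertBasis ι ℂ (L2Space d))
    {K S : Set 𝔼} (hK : MeasurableSet K) (hS : MeasurableSet S)
    (hSfin : volume S ≠ ∞) :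
    ∑' i, ‖indicatorProj Kᶜ hK.compl (bandProj S hS (indicatorProj K hK (b i)))‖ₑ ^ 2
      = ∫⁻ x in Kᶜ, ∫⁻ y in K, ‖bandKernel S (y - x)‖ₑ ^ 2 := by
  rw [tsum_enorm_sq_of_inner_repr b
    (A := fun e => indicatorProj Kᶜ hK.compl (bandProj S hS (indicatorProj K hK e)))
    -- The value of `Q P e` at `x` pairs `𝓕 (P e)` with a plane wave; moving `𝓕` and `P` to the
    -- other side gives the representing vector.
    (a := Kᶜ.indicator fun x =>
      indicatorProj K hK (𝓕⁻ (planeWave S hS hSfin (-x)) : L2Space d)),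
    ← lintegral_indicator hK.compl]
  · congr 1
    ext x
    by_cases hx : x ∈ Kᶜ
    · rw [Set.indicator_of_mem hx, Set.indicator_of_mem hx, enorm_sq_eq_lintegral,
        ← lintegral_indicator hK]
      refine lintegral_congr_ae ?_
      filter_upwards [coeFn_indicatorProj hK (𝓕⁻ (planeWave S hS hSfin (-x)) : L2Space d),
        coeFn_fourierInv_planeWave hS hSfin x] with y h1 h2
      rw [h1]
      by_cases hy : y ∈ K <;> simp [hy, h2]
    · simp [hx]
  · intro e
    filter_upwards [coeFn_indicatorProj hK.compl (bandProj S hS (indicatorProj K hK e)),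
      coeFn_fourierInv_indicatorProj hS hSfin (𝓕 (indicatorProj K hK e) : L2Space d)] with x h1 h2
    rw [h1]
    by_cases hx : x ∈ Kᶜ
    · rw [Set.indicator_of_mem hx, Set.indicator_of_mem hx, bandProj_apply, h2,
        inner_indicatorProj_left, inner_fourierInv_left]
    · simp [hx]

/-- The operator `P_K Q_S P_K` of first space-limiting, then band-limiting, then space-limiting. -/
noncomputable def spaceBandLimiting (K S : Set 𝔼) (hK : MeasurableSet K) (hS : MeasurableSet S) :
    L2Space d →L[ℂ] L2Space d :=
  indicatorProj K hK ∘L bandProj S hS ∘L indicatorProj K hK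

theorem spaceBandLimiting_apply {K : Set 𝔼} (hK : MeasurableSet K) {S : Set 𝔼}
    (hS : MeasurableSet S) (f : L2Space d) : spaceBandLimiting K S hK hS f =
    indicatorProj K hK (bandProj S hS (indicatorProj K hK f)) := rfl

theorem inner_bandProj_left {S : Set 𝔼} (hS : MeasurableSet S) (f g : L2Space d) :
    inner ℂ (bandProj S hS f) g = inner ℂ f (bandProj S hS g) := by
  rw [bandProj_apply, bandProj_apply, inner_fourierInv_left, inner_fourierInv_right,
    inner_indicatorProj_left]

theorem norm_bandProj {S : Set 𝔼} (hS : MeasurableSet S) (f : L2Space d) :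
    ‖bandProj S hS f‖ = ‖indicatorProj S hS (𝓕 f : L2Space d)‖ :=
  (Lp.fourierTransformₗᵢ 𝔼 ℂ).symm.norm_map _

theorem bandProj_idem {S : Set 𝔼} (hS : MeasurableSet S)
    (f : L2Space d) : bandProj S hS (bandProj S hS f) = bandProj S hS f := by
  rw [bandProj_apply, bandProj_apply, FourierTransform.fourier_fourierInv_eq, indicatorProj_idem]

theorem isSymmetric_spaceBandLimiting {K : Set 𝔼} (hK : MeasurableSet K) {S : Set 𝔼}
    (hS : MeasurableSet S) :
    (spaceBandLimiting K S hK hS : L2Space d →ₗ[ℂ] L2Space d).IsSymmetric := by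
  intro f g
  change inner ℂ (indicatorProj K hK (bandProj S hS (indicatorProj K hK f))) g =
    inner ℂ f (indicatorProj K hK (bandProj S hS (indicatorProj K hK g)))
  rw [inner_indicatorProj_left, inner_bandProj_left, inner_indicatorProj_left]

/-- The operator is `A* A` with `A = 1_S 𝓕 P_K`. Its eigenvalues are thus nonnegative, and its trace
is the squared Hilbert-Schmidt norm of `A`. -/
theorem inner_spaceBandLimiting_self {K : Set 𝔼} (hK : MeasurableSet K) {S : Set 𝔼}
    (hS : MeasurableSet S) (f : L2Space d) :
    inner ℂ f (spaceBandLimiting K S hK hS f) =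
      ((‖indicatorProj S hS (𝓕 (indicatorProj K hK f) : L2Space d)‖ ^ 2 : ℝ) : ℂ) := by
  rw [spaceBandLimiting_apply, ← inner_indicatorProj_left, ← bandProj_idem, ← inner_bandProj_left,
    inner_self_eq_norm_sq_to_K, norm_bandProj]
  norm_cast

theorem norm_sq_indicatorProj_add_compl {K : Set 𝔼} (hK : MeasurableSet K) (f : L2Space d) :
    ‖indicatorProj K hK f‖ ^ 2 + ‖indicatorProj Kᶜ hK.compl f‖ ^ 2 = ‖f‖ ^ 2 := by
  have hsum : indicatorProj K hK f + indicatorProj Kᶜ hK.compl f = f := by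
    apply Lp.ext
    filter_upwards [coeFn_indicatorProj hK f, coeFn_indicatorProj hK.compl f,
      Lp.coeFn_add (indicatorProj K hK f) (indicatorProj Kᶜ hK.compl f)] with x h1 h2 h3
    rw [h3, Pi.add_apply, h1, h2]
    exact congrFun (Set.indicator_self_add_compl K f) x
  have horth : inner ℂ (indicatorProj K hK f) (indicatorProj Kᶜ hK.compl f) = 0 := by
    rw [L2.inner_def, integral_eq_zero_of_ae]
    filter_upwards [coeFn_indicatorProj hK f, coeFn_indicatorProj hK.compl f] with x h1 h2
    rw [h1, h2]
    by_cases hx : x ∈ K <;> simp [hx]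
  have := norm_add_sq_eq_norm_sq_add_norm_sq_of_inner_eq_zero _ _ horth
  rw [hsum] at this
  nlinarith

theorem norm_indicatorProj_le {K : Set 𝔼} (hK : MeasurableSet K)
    (f : L2Space d) : ‖indicatorProj K hK f‖ ≤ ‖f‖ := by
  have := norm_sq_indicatorProj_add_compl hK f
  exact le_of_sq_le_sq (by nlinarith [sq_nonneg ‖indicatorProj Kᶜ hK.compl f‖]) (norm_nonneg f)

theorem norm_spaceBandLimiting_le {K : Set 𝔼} (hK : MeasurableSet K) {S : Set 𝔼}
    (hS : MeasurableSet S) (f : L2Space d) : ‖spaceBandLimiting K S hK hS f‖ ≤ ‖f‖ := by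
  rw [spaceBandLimiting_apply]
  refine (norm_indicatorProj_le hK _).trans ?_
  rw [norm_bandProj]
  refine (norm_indicatorProj_le hS _).trans ?_
  rw [Lp.norm_fourier_eq]
  exact norm_indicatorProj_le hK f

/-- Pythagoras for `Q P f` across `K` and its complement. On a unit eigenvector it reads `Λ² +
leakage = Λ`, which makes `Λ - Λ²` summable with a computable sum. -/
theorem norm_sq_spaceBandLimiting_add {K : Set 𝔼} (hK : MeasurableSet K) {S : Set 𝔼}
    (hS : MeasurableSet S) (f : L2Space d) :
    ‖spaceBandLimiting K S hK hS f‖ ^ 2 +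
        ‖indicatorProj Kᶜ hK.compl (bandProj S hS (indicatorProj K hK f))‖ ^ 2 =
      ‖indicatorProj S hS (𝓕 (indicatorProj K hK f) : L2Space d)‖ ^ 2 := by
  rw [spaceBandLimiting_apply, norm_sq_indicatorProj_add_compl, norm_bandProj]

theorem countable_of_hilbertBasis (b : HilbertBasis ι ℂ (L2Space d)) : Countable ι := by
  have : Fact ((2 : ℝ≥0∞) ≠ ∞) := ⟨by norm_num⟩
  exact b.orthonormal.countable_of_separableSpace

theorem hasSum_norm_sq_of_tsum_enorm_sq {F : Type*} [NormedAddCommGroup F] {v : ι → F} {c : ℝ≥0∞}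
    (hc : c ≠ ∞) (h : ∑' i, ‖v i‖ₑ ^ 2 = c) : HasSum (fun i => ‖v i‖ ^ 2) c.toReal := by
  have h1 : ∀ i, (‖v i‖ₑ ^ 2).toReal = ‖v i‖ ^ 2 := by simp
  have := ENNReal.hasSum_toReal (f := fun i => ‖v i‖ₑ ^ 2) (by rwa [h])
  rw [← ENNReal.tsum_toReal_eq fun i => by simp, h] at this
  simpa only [h1] using this

/-- The factor `1_S 𝓕 P_K` is Hilbert-Schmidt, hence compact, and the remaining factor `P_K 𝓕⁻¹` is
bounded. -/
theorem isCompactOperator_spaceBandLimiting {K : Set 𝔼} (hK : MeasurableSet K) {S : Set 𝔼}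
    (hS : MeasurableSet S) (hKfin : volume K ≠ ∞) (hSfin : volume S ≠ ∞) :
    IsCompactOperator (spaceBandLimiting K S hK hS) := by
  obtain ⟨w, b, -⟩ := exists_hilbertBasis ℂ (L2Space d)
  have := countable_of_hilbertBasis b
  have hsum := hasSum_norm_sq_of_tsum_enorm_sq (ENNReal.mul_ne_top hKfin hSfin)
    (tsum_enorm_sq_fourier_indicatorProj b hK hKfin hS)
  let F₂ := Lp.fourierTransformₗᵢ 𝔼 ℂ
  have hc := b.isCompactOperator_of_summable
    (indicatorProj S hS ∘L (F₂.toContinuousLinearEquiv : L2Space d →L[ℂ] L2Space d) ∘L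
      indicatorProj K hK) hsum.summable
  exact hc.clm_comp (indicatorProj K hK ∘L
    (F₂.symm.toContinuousLinearEquiv : L2Space d →L[ℂ] L2Space d))

end TraceFormulas

/-! ### The leakage is of lower order than the volume. -/

section LeakageAsymptotics

variable {d : ℕ}

local notation "𝔼" => EuclideanSpace ℝ (Fin d)

theorem measurableSet_mem_and_sub_notMem {K : Set 𝔼} (hK : MeasurableSet K) :
    MeasurableSet {p : 𝔼 × 𝔼 | p.2 ∈ K ∧ p.2 - p.1 ∉ K} :=
  (measurable_snd hK).inter ((measurable_snd.sub measurable_fst) hK.compl)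

/-- Tonelli and the substitution `z = y - x`: each shift `z` is weighted by the volume of the part
of `K` lying outside `K + z`. -/
theorem lintegral_compl_lintegral_sub {K : Set 𝔼} (hK : MeasurableSet K) {f : 𝔼 → ℝ≥0∞}
    (hf : Measurable f) :
    ∫⁻ x in Kᶜ, ∫⁻ y in K, f (y - x) = ∫⁻ z, f z * volume {y | y ∈ K ∧ y - z ∉ K} := by
  have hM := measurableSet_mem_and_sub_notMem hK
  calc ∫⁻ x in Kᶜ, ∫⁻ y in K, f (y - x)
      = ∫⁻ y in K, ∫⁻ x in Kᶜ, f (y - x) :=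
        lintegral_lintegral_swap (hf.comp (measurable_snd.sub measurable_fst)).aemeasurable
    _ = ∫⁻ y, ∫⁻ z, {p : 𝔼 × 𝔼 | p.2 ∈ K ∧ p.2 - p.1 ∉ K}.indicator (fun p => f p.1) (z, y) := by
        rw [← lintegral_indicator hK]
        congr 1
        ext y
        by_cases hy : y ∈ K
        · rw [Set.indicator_of_mem hy, ← lintegral_indicator hK.compl,
            ← lintegral_sub_left_eq_self _ y]
          congr 1
          ext z
          by_cases hz : y - z ∈ K <;> simp [hy, hz]
        · simp [hy]
    _ = ∫⁻ z, ∫⁻ y, {p : 𝔼 × 𝔼 | p.2 ∈ K ∧ p.2 - p.1 ∉ K}.indicator (fun p => f p.1) (z, y) :=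
        lintegral_lintegral_swap (((hf.comp measurable_fst).indicator hM).comp
          measurable_swap).aemeasurable
    _ = ∫⁻ z, f z * volume {y | y ∈ K ∧ y - z ∉ K} := by
        congr 1
        ext z
        have hMz : MeasurableSet {y | y ∈ K ∧ y - z ∉ K} := measurable_prodMk_left hM
        rw [← setLIntegral_const, ← lintegral_indicator hMz]
        rfl

theorem volume_smul_mem_and_sub_notMem (Ω : Set 𝔼) {r : ℝ} (hr : 0 < r) (z : 𝔼) :
    volume {y | y ∈ r • Ω ∧ y - z ∉ r • Ω} =
      ENNReal.ofReal (r ^ d) * volume {y | y ∈ Ω ∧ y - r⁻¹ • z ∉ Ω} := by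
  have : {y | y ∈ r • Ω ∧ y - z ∉ r • Ω} = r • {y | y ∈ Ω ∧ y - r⁻¹ • z ∉ Ω} := by
    ext y
    simp only [Set.mem_ofPred_eq, Set.mem_smul_set_iff_inv_smul_mem₀ hr.ne', smul_sub]
  rw [this, Measure.addHaar_smul, finrank_euclideanSpace_fin, abs_of_pos (by positivity)]

/-- Up to translation the set lies in a closed thickening of `Ω` minus `Ω`. The thickenings shrink
to the compact set `Ω`, so no regularity of its boundary is needed. -/
theorem tendsto_volume_mem_and_sub_notMem {Ω : Set 𝔼} (hΩ : IsCompact Ω) :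
    Tendsto (fun h : 𝔼 => volume {y | y ∈ Ω ∧ y - h ∉ Ω}) (𝓝 0) (𝓝 0) := by
  have hle : ∀ h : 𝔼, volume {y | y ∈ Ω ∧ y - h ∉ Ω} ≤
      volume (Metric.cthickening ‖h‖ Ω) - volume Ω := by
    intro h
    rw [← measure_sdiff (Metric.self_subset_cthickening Ω) hΩ.measurableSet.nullMeasurableSet
      hΩ.measure_lt_top.ne, ← measure_preimage_add_right volume h {y | y ∈ Ω ∧ y - h ∉ Ω}]
    apply measure_mono
    rintro y ⟨hy1, hy2⟩
    refine ⟨Metric.mem_cthickening_of_dist_le y (y + h) _ _ hy1 (by simp [dist_eq_norm]), ?_⟩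
    simpa using hy2
  have hlim : Tendsto (fun h : 𝔼 => volume (Metric.cthickening ‖h‖ Ω) - volume Ω) (𝓝 0)
      (𝓝 (volume Ω - volume Ω)) := by
    have h1 : Tendsto (fun h : 𝔼 => volume (Metric.cthickening ‖h‖ Ω)) (𝓝 0) (𝓝 (volume Ω)) :=
      (tendsto_measure_cthickening_of_isCompact hΩ).comp
        (by simpa using (continuous_norm (E := 𝔼)).tendsto 0)
    exact ENNReal.Tendsto.sub h1 tendsto_const_nhds (Or.inr hΩ.measure_lt_top.ne)
  rw [tsub_self] at hlim
  exact tendsto_of_tendsto_of_tendsto_of_le_of_le tendsto_const_nhds hlim (fun _ => zero_le) hle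

/-- Scaling by `r` turns the shift `z` into `r⁻¹ • z` and extracts `r ^ d`; dominated convergence
with majorant `f z * volume Ω` then applies. -/
theorem tendsto_lintegral_compl_smul_div {Ω : Set 𝔼} (hΩ : IsCompact Ω) {f : 𝔼 → ℝ≥0∞}
    (hf : Measurable f) (hfin : ∫⁻ z, f z ≠ ∞) :
    Tendsto (fun r : ℝ => (∫⁻ x in (r • Ω)ᶜ, ∫⁻ y in r • Ω, f (y - x)) / ENNReal.ofReal (r ^ d))
      atTop (𝓝 0) := by
  have hM := measurable_measure_prodMk_left (ν := (volume : Measure 𝔼))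
    (measurableSet_mem_and_sub_notMem hΩ.measurableSet)
  have hlim : Tendsto (fun r : ℝ => ∫⁻ z, f z * volume {y | y ∈ Ω ∧ y - r⁻¹ • z ∉ Ω}) atTop
      (𝓝 (∫⁻ z : 𝔼, f z * 0)) := by
    refine tendsto_lintegral_filter_of_dominated_convergence (fun z => f z * volume Ω)
      (Eventually.of_forall fun r => ?_) (Eventually.of_forall fun r => ?_) ?_ ?_
    · exact hf.mul (hM.comp (measurable_const_smul r⁻¹))
    · refine Eventually.of_forall fun z => ?_
      gcongr
      exact fun y hy => hy.1
    · rw [lintegral_mul_const _ hf]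
      exact ENNReal.mul_ne_top hfin hΩ.measure_lt_top.ne
    · have hfz : ∀ᵐ z, f z < ∞ := ae_lt_top hf hfin
      filter_upwards [hfz] with z hz
      refine ENNReal.Tendsto.const_mul ?_ (Or.inr hz.ne)
      refine (tendsto_volume_mem_and_sub_notMem hΩ).comp ?_
      have := (tendsto_inv_atTop_zero (𝕜 := ℝ)).smul_const z
      rwa [zero_smul] at this
  simp only [mul_zero, lintegral_zero] at hlim
  refine hlim.congr' ?_
  filter_upwards [eventually_gt_atTop 0] with r hr
  have hpos : 0 < r ^ d := by positivity
  rw [lintegral_compl_lintegral_sub (hΩ.smul r).measurableSet hf]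
  simp_rw [volume_smul_mem_and_sub_notMem Ω hr, mul_left_comm (f _)]
  rw [lintegral_const_mul' _ _ ENNReal.ofReal_ne_top, mul_comm,
    ENNReal.mul_div_cancel_right (by simpa using hpos) ENNReal.ofReal_ne_top]

end LeakageAsymptotics

/-! ### Coverings of Euclidean balls with a sharp exponential rate. -/

section BallCovering

variable {W : Type*} [NormedAddCommGroup W] [InnerProductSpace ℝ W] [FiniteDimensional ℝ W]
  [MeasurableSpace W] [BorelSpace W]

open Module Metric

theorem measureReal_unitClosedBall_pos : 0 < volume.real (closedBall (0 : W) 1) :=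
  ENNReal.toReal_pos (measure_closedBall_pos volume 0 one_pos).ne' measure_closedBall_lt_top.ne

/-- Volume bound for coverings of balls. -/
theorem pow_finrank_le_card_mul_of_closedBall_subset {a ε : ℝ} (ha : 0 ≤ a) (hε : 0 ≤ ε)
    (t : Finset W) (h : closedBall (0 : W) a ⊆ ⋃ y ∈ t, closedBall y ε) :
    a ^ finrank ℝ W ≤ t.card * ε ^ finrank ℝ W := by
  have h1 : volume.real (closedBall (0 : W) a) ≤ ∑ y ∈ t, volume.real (closedBall y ε) := by
    refine (measureReal_mono h ?_).trans (measureReal_biUnion_finset_le _ _)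
    exact (measure_biUnion_lt_top t.finite_toSet fun y _ => measure_closedBall_lt_top).ne
  simp only [Measure.addHaar_real_closedBall' volume _ ha,
    Measure.addHaar_real_closedBall' volume _ hε,
    Finset.sum_const, nsmul_eq_mul, ← mul_assoc] at h1
  exact le_of_mul_le_mul_right h1 measureReal_unitClosedBall_pos

theorem card_le_of_isSeparated_of_subset_closedBall {σ : ℝ≥0} (hσ : 0 < σ) (t : Finset W)
    (ht : (t : Set W) ⊆ closedBall 0 1) (hsep : IsSeparated (σ : ℝ≥0∞) (t : Set W)) :
    (t.card : ℝ) ≤ (1 + 2 / σ) ^ finrank ℝ W := by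
  have hσ' : (0 : ℝ) < σ := hσ
  have hdisj : (t : Set W).PairwiseDisjoint fun y => closedBall y (σ / 2 : ℝ) := by
    intro x hx y hy hxy
    apply closedBall_disjoint_closedBall
    have : (σ : ℝ≥0∞) < edist x y := hsep hx hy hxy
    rw [edist_nndist] at this
    have h2 : (σ : ℝ) < dist x y := by exact_mod_cast this
    linarith
  have hsub : (⋃ y ∈ t, closedBall y (σ / 2 : ℝ)) ⊆ closedBall (0 : W) (1 + σ / 2) := by
    refine Set.iUnion₂_subset fun y hy => closedBall_subset_closedBall' ?_
    have := mem_closedBall.1 (ht hy)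
    linarith
  have h1 := measureReal_mono hsub (measure_closedBall_lt_top (μ := volume)).ne
  rw [measureReal_biUnion_finset hdisj (fun _ _ => measurableSet_closedBall)
    (fun _ _ => measure_closedBall_lt_top.ne)] at h1
  simp only [Measure.addHaar_real_closedBall' volume _ (show 0 ≤ (σ / 2 : ℝ) by positivity),
    Measure.addHaar_real_closedBall' volume _ (show 0 ≤ (1 + σ / 2 : ℝ) by positivity),
    Finset.sum_const, nsmul_eq_mul, ← mul_assoc] at h1
  have h2 := le_of_mul_le_mul_right h1 measureReal_unitClosedBall_pos
  have h3 : (1 + 2 / σ : ℝ) = (1 + σ / 2) / (σ / 2) := by field_simp; ring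
  rw [h3, div_pow, le_div_iff₀ (by positivity)]
  exact h2

/-- A maximal separated set is a net. Its crude size is harmless: it only supplies finitely many
targets for the random covering, where its cardinality enters through a logarithm. -/
theorem exists_finset_net_closedBall {σ : ℝ≥0} (hσ : 0 < σ) :
    ∃ t : Finset W, (t.card : ℝ) ≤ (1 + 2 / σ) ^ finrank ℝ W ∧
      (t : Set W) ⊆ closedBall 0 1 ∧
      ∀ x ∈ closedBall (0 : W) 1, ∃ y ∈ t, dist x y ≤ σ := by
  have hbound : packingNumber σ (closedBall (0 : W) 1) ≠ ⊤ := by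
    set N := ⌊(1 + 2 / σ : ℝ) ^ finrank ℝ W⌋₊
    suffices packingNumber σ (closedBall (0 : W) 1) ≤ N from
      ne_top_of_le_ne_top (ENat.natCast_ne_top N) this
    refine iSup_le fun C => iSup_le fun hC => iSup_le fun hsep => ?_
    by_contra! hlt
    obtain ⟨C', hC', hcard⟩ := Set.exists_subset_encard_eq
      (show ((N + 1 : ℕ) : ℕ∞) ≤ C.encard from by exact_mod_cast Order.add_one_le_of_lt hlt)
    have hfin : C'.Finite := Set.finite_of_encard_eq_coe hcard
    have h1 := card_le_of_isSeparated_of_subset_closedBall hσ hfin.toFinset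
      (by simpa using hC'.trans hC) (by simpa using hsep.subset hC')
    have h2 : hfin.toFinset.card = N + 1 := by
      rw [hfin.encard_eq_coe_toFinset_card] at hcard
      exact_mod_cast hcard
    have := Nat.le_floor h1
    omega
  have hfin : (maximalSeparatedSet σ (closedBall (0 : W) 1)).Finite := by
    rw [← Set.encard_ne_top_iff, encard_maximalSeparatedSet hbound]
    exact hbound
  refine ⟨hfin.toFinset, card_le_of_isSeparated_of_subset_closedBall hσ _ ?_ ?_, ?_,
    fun x hx => ?_⟩
  · simpa using maximalSeparatedSet_subset
  · simpa using isSeparated_maximalSeparatedSet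
  · simpa using maximalSeparatedSet_subset
  · obtain ⟨y, hy, hxy⟩ := isCover_maximalSeparatedSet hbound hx
    refine ⟨y, by simpa using hy, ?_⟩
    have hxy' : edist x y ≤ σ := hxy
    rw [edist_nndist] at hxy'
    exact_mod_cast hxy'

/-- Pigeonhole over parallel slabs: restricting to the heaviest one costs a factor independent of
the dimension. -/
theorem exists_slab_measureReal_ge {ω : ℝ} (hω : 0 < ω) {ρ : ℝ} (hρ : ρ ≤ 1) {u : W}
    (hu : ‖u‖ ≤ 1) :
    ∃ c : ℝ, volume.real (closedBall (0 : W) ρ) ≤ (⌊1 / ω⌋₊ + 1 : ℝ) *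
      volume.real {w ∈ closedBall (0 : W) ρ | |inner ℝ w u - c| ≤ ω} := by
  set K := ⌊1 / ω⌋₊ + 1
  -- Midpoints of consecutive intervals of length `2 * ω` starting at `-1`; `⌊1 / ω⌋₊ + 1` of them
  -- cover `[-1, 1]`.
  let c : ℕ → ℝ := fun j => -1 + (2 * j + 1) * ω
  let A : ℕ → Set W := fun j => {w ∈ closedBall (0 : W) ρ | |inner ℝ w u - c j| ≤ ω}
  have hA : ∀ j, A j ⊆ closedBall (0 : W) ρ := fun j w hw => hw.1
  have hcov : closedBall (0 : W) ρ ⊆ ⋃ j ∈ Finset.range K, A j := by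
    intro w hw
    have hw1 : ‖w‖ ≤ 1 := (mem_closedBall_zero_iff.1 hw).trans hρ
    have h1 : |inner ℝ w u| ≤ 1 := (abs_real_inner_le_norm w u).trans
      (mul_le_one₀ hw1 (norm_nonneg _) hu)
    obtain ⟨h2, h3⟩ := abs_le.1 h1
    have h0 : 0 ≤ (inner ℝ w u + 1) / (2 * ω) := div_nonneg (by linarith) (by linarith)
    set j := ⌊(inner ℝ w u + 1) / (2 * ω)⌋₊
    have h4 := Nat.floor_le h0
    have h5 := Nat.lt_floor_add_one ((inner ℝ w u + 1) / (2 * ω))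
    rw [le_div_iff₀ (by positivity)] at h4
    rw [div_lt_iff₀ (by positivity)] at h5
    have hjK : j < K := by
      refine Nat.lt_succ_of_le (Nat.floor_le_floor ?_)
      rw [div_le_div_iff₀ (by positivity) hω]
      nlinarith
    refine Set.mem_biUnion (Finset.mem_coe.2 (Finset.mem_range.2 hjK)) ⟨hw, ?_⟩
    rw [abs_le]
    constructor <;> simp only [c] <;> nlinarith
  obtain ⟨j, -, hj⟩ := Finset.exists_max_image (Finset.range K) (fun j => volume.real (A j))
    ⟨0, by simp [K]⟩
  refine ⟨c j, ?_⟩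
  have h1 : volume.real (closedBall (0 : W) ρ) ≤ ∑ j ∈ Finset.range K, volume.real (A j) := by
    refine (measureReal_mono hcov ?_).trans (measureReal_biUnion_finset_le _ _)
    exact (measure_biUnion_lt_top (Finset.range K).finite_toSet fun j _ =>
      (measure_mono (hA j)).trans_lt measure_closedBall_lt_top).ne
  refine h1.trans ((Finset.sum_le_card_nsmul _ _ _ hj).trans ?_)
  rw [Finset.card_range, nsmul_eq_mul]
  push_cast [K]
  rfl

/-- The lens `B(x, r) ∩ B(0, R)` contains a translate of a slab of a ball of radius `ε s`,
where `ε² + s² = 1` and `r`, `R` are slightly larger than `ε`, `s`. -/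
theorem measureReal_closedBall_inter_ge {ε s ω r R : ℝ}
    (hεs : ε ^ 2 + s ^ 2 = 1) (hω : 0 < ω) (hr : 0 ≤ r) (hR : 0 ≤ R)
    (hrω : ε ^ 2 + 2 * ε ^ 2 * ω + ω ^ 2 ≤ r ^ 2) (hRω : s ^ 2 + 2 * s ^ 2 * ω + ω ^ 2 ≤ R ^ 2)
    {x : W} (hx : ‖x‖ ≤ 1) :
    volume.real (closedBall (0 : W) (ε * s)) ≤ (⌊1 / ω⌋₊ + 1 : ℝ) *
      volume.real (closedBall (0 : W) R ∩ closedBall x r) := by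
  -- The direction of `x`, with `u = 0` when `x = 0`; the last identity treats both cases at once.
  obtain ⟨u, hu, hxu, hux⟩ : ∃ u : W, ‖u‖ ≤ 1 ∧ x = ‖x‖ • u ∧ ‖x‖ * ‖u‖ ^ 2 = ‖x‖ := by
    by_cases h0 : x = 0
    · exact ⟨0, by simp, by simp [h0], by simp [h0]⟩
    · have h1 : ‖(‖x‖⁻¹ • x)‖ = 1 := by
        rw [norm_smul, norm_inv, norm_norm, inv_mul_cancel₀ (norm_ne_zero_iff.2 h0)]
      exact ⟨‖x‖⁻¹ • x, h1.le, by rw [smul_inv_smul₀ (norm_ne_zero_iff.2 h0)], by simp [h1]⟩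
  have hρ : ε * s ≤ 1 := by nlinarith [sq_nonneg (ε - s)]
  obtain ⟨c, hc⟩ := exists_slab_measureReal_ge hω hρ hu
  refine hc.trans (mul_le_mul_of_nonneg_left ?_ (by positivity))
  set A := {w ∈ closedBall (0 : W) (ε * s) | |inner ℝ w u - c| ≤ ω}
  -- This translation puts the slab around `s² x`. For a unit vector `x`, an offset of length `ε s`
  -- orthogonal to `x` lands at distance `s` from `0` and `ε` from `x`, as `s⁴ + ε² s² = s²` and `ε⁴
  -- + ε² s² = ε²`.
  set v := s ^ 2 • x - c • u
  have hvol : volume.real A = volume.real ((fun w => w + (-v)) ⁻¹' A) := by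
    rw [measureReal_def, measureReal_def, measure_preimage_add_right]
  rw [hvol]
  refine measureReal_mono ?_ ((measure_mono Set.inter_subset_left).trans_lt
    measure_closedBall_lt_top).ne
  rintro y ⟨hy1, hy2⟩
  set w := y + -v
  obtain ⟨h1, h2⟩ := abs_le.1 hy2
  have hw : ‖w‖ ^ 2 ≤ (ε * s) ^ 2 := by
    have := mem_closedBall_zero_iff.1 hy1
    gcongr
  set z := w - c • u
  have hz : ‖z‖ ^ 2 ≤ (ε * s) ^ 2 + ω ^ 2 := by
    rw [norm_sub_sq_real, inner_smul_right, norm_smul, mul_pow, Real.norm_eq_abs, sq_abs]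
    have hu2 : ‖u‖ ^ 2 ≤ 1 := pow_le_one₀ (norm_nonneg _) hu
    have h3 : c ^ 2 * ‖u‖ ^ 2 ≤ c ^ 2 := mul_le_of_le_one_right (sq_nonneg _) hu2
    have h4 : (inner ℝ w u - c) ^ 2 ≤ ω ^ 2 := sq_le_sq' h1 h2
    have h5 : -2 * (c * (inner ℝ w u - c)) ≤ c ^ 2 + (inner ℝ w u - c) ^ 2 := by
      nlinarith [sq_nonneg (c + (inner ℝ w u - c))]
    nlinarith
  have hzx : |inner ℝ x z| ≤ ω := by
    have h3 : inner ℝ x z = ‖x‖ * (inner ℝ w u - c) := by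
      rw [hxu, real_inner_smul_left, inner_sub_right, inner_smul_right, real_inner_self_eq_norm_sq,
        real_inner_comm, ← hxu]
      linear_combination -c * hux
    rw [h3, abs_mul, abs_norm]
    exact (mul_le_of_le_one_left (abs_nonneg _) hx).trans hy2
  obtain ⟨h3, h4⟩ := abs_le.1 hzx
  have hx2 : ‖x‖ ^ 2 ≤ 1 := pow_le_one₀ (norm_nonneg _) hx
  have hyz : y = s ^ 2 • x + z := by simp only [z, w, v]; abel
  have hyz' : y - x = z - ε ^ 2 • x := by
    rw [hyz, show s ^ 2 = 1 - ε ^ 2 by linarith, sub_smul, one_smul]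
    abel
  refine ⟨mem_closedBall_zero_iff.2 (le_of_sq_le_sq ?_ hR), mem_closedBall_iff_norm.2
    (le_of_sq_le_sq ?_ hr)⟩
  · rw [hyz, norm_add_sq_real, real_inner_smul_left, norm_smul, mul_pow, Real.norm_eq_abs, sq_abs]
    have h5 : (s ^ 2) ^ 2 * ‖x‖ ^ 2 ≤ (s ^ 2) ^ 2 := mul_le_of_le_one_right (sq_nonneg _) hx2
    have h6 : s ^ 2 * inner ℝ x z ≤ s ^ 2 * ω := mul_le_mul_of_nonneg_left h4 (sq_nonneg _)
    have h7 : (s ^ 2) ^ 2 + (ε * s) ^ 2 = s ^ 2 := by linear_combination s ^ 2 * hεs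
    linarith
  · rw [hyz', norm_sub_sq_real, real_inner_smul_right, norm_smul, mul_pow, Real.norm_eq_abs, sq_abs,
      real_inner_comm]
    have h5 : (ε ^ 2) ^ 2 * ‖x‖ ^ 2 ≤ (ε ^ 2) ^ 2 := mul_le_of_le_one_right (sq_nonneg _) hx2
    have h6 : ε ^ 2 * -ω ≤ ε ^ 2 * inner ℝ x z := mul_le_mul_of_nonneg_left h3 (sq_nonneg _)
    have h7 : (ε ^ 2) ^ 2 + (ε * s) ^ 2 = ε ^ 2 := by linear_combination ε ^ 2 * hεs
    linarith

/-- Greedy covering: if each of finitely many points `x` is hit by a random `y` with probability at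
least `p`, then `m` well-chosen values of `y` hit all but a proportion `(1 - p) ^ m` of them. -/
theorem exists_finset_card_filter_forall_notMem_le {α Y : Type*} [MeasurableSpace Y]
    (μ : Measure Y) [IsProbabilityMeasure μ] {U : α → Set Y} (hU : ∀ x, MeasurableSet (U x))
    (X : Finset α) {p : ℝ} (hp1 : p ≤ 1) (hp : ∀ x ∈ X, p ≤ μ.real (U x)) (m : ℕ) :
    ∃ t : Finset Y, t.card ≤ m ∧ ∃ Z ⊆ X, (∀ x ∈ X, x ∉ Z → ∃ y ∈ t, y ∈ U x) ∧
      (Z.card : ℝ) ≤ (1 - p) ^ m * X.card := by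
  classical
  induction m with
  | zero => exact ⟨∅, by simp, X, subset_rfl, by simp, by simp⟩
  | succ m ih =>
    obtain ⟨t, ht, Z, hZX, hZ, hcard⟩ := ih
    have hint : ∀ x ∈ Z, Integrable ((U x).indicator fun _ => (1 : ℝ)) μ := fun x _ =>
      (integrable_const 1).indicator (hU x)
    -- Some `y` hits at least the expected number of the points of `Z`, those not hit so far.
    obtain ⟨y, hy⟩ := exists_integral_le (integrable_finsetSum Z hint)
    have h1 : ∫ y, ∑ x ∈ Z, (U x).indicator (fun _ => (1 : ℝ)) y ∂μ = ∑ x ∈ Z, μ.real (U x) := by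
      rw [integral_finsetSum Z hint]
      exact Finset.sum_congr rfl fun x _ => integral_indicator_one (hU x)
    have h2 : (Z.card : ℝ) * p ≤ ∑ x ∈ Z, μ.real (U x) := by
      rw [← nsmul_eq_mul]
      exact Finset.card_nsmul_le_sum _ _ _ fun x hx => hp x (hZX hx)
    have h3 : ∑ x ∈ Z, (U x).indicator (fun _ => (1 : ℝ)) y = (Z.filter (y ∈ U ·)).card := by
      rw [Finset.card_filter]
      push_cast
      exact Finset.sum_congr rfl fun x _ => by by_cases h : y ∈ U x <;> simp [h]
    have h4 := Z.card_filter_add_card_filter_not (y ∈ U ·)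
    refine ⟨insert y t, (Finset.card_insert_le _ _).trans (by omega), Z.filter (y ∉ U ·),
      (Finset.filter_subset _ _).trans hZX, fun x hx hxZ => ?_, ?_⟩
    · by_cases hxZ' : x ∈ Z
      · refine ⟨y, Finset.mem_insert_self _ _, ?_⟩
        by_contra h
        exact hxZ (Finset.mem_filter.2 ⟨hxZ', h⟩)
      · obtain ⟨y', hy', h⟩ := hZ x hx hxZ'
        exact ⟨y', Finset.mem_insert_of_mem hy', h⟩
    · have h5 : ((Z.filter (y ∈ U ·)).card : ℝ) + (Z.filter (y ∉ U ·)).card = Z.card := by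
        exact_mod_cast h4
      rw [pow_succ]
      have h6 : (1 - p) * Z.card ≤ (1 - p) * ((1 - p) ^ m * X.card) :=
        mul_le_mul_of_nonneg_left hcard (by linarith)
      rw [h1, h3] at hy
      nlinarith

/-- Used with `x = q / q₁` to absorb a factor linear in the dimension into a slightly worse
exponential base. -/
theorem exists_forall_succ_mul_pow_le {x : ℝ} (h0 : 0 ≤ x) (h1 : x < 1) :
    ∃ M : ℝ, 0 < M ∧ ∀ n : ℕ, (n + 1) * x ^ n ≤ M := by
  have hlim : Tendsto (fun n : ℕ => (n + 1 : ℝ) * x ^ n) atTop (𝓝 (0 + 0)) := by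
    simp only [add_one_mul]
    exact (tendsto_self_mul_const_pow_of_lt_one h0 h1).add
      (tendsto_pow_atTop_nhds_zero_of_lt_one h0 h1)
  obtain ⟨M, hM⟩ := hlim.bddAbove_range
  refine ⟨max M 1, by positivity, fun n => le_max_of_le_left (hM ⟨n, rfl⟩)⟩

theorem exists_pos_quadratic_le {a b : ℝ} (hab : a < b) (c : ℝ) :
    ∀ᶠ ω : ℝ in 𝓝[>] 0, a + c * ω + ω ^ 2 ≤ b := by
  have h : Tendsto (fun ω : ℝ => a + c * ω + ω ^ 2) (𝓝[>] 0) (𝓝 (a + c * 0 + 0 ^ 2)) :=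
    Continuous.tendsto (by fun_prop : Continuous fun ω : ℝ => a + c * ω + ω ^ 2) 0 |>.mono_left
      nhdsWithin_le_nhds
  exact (h.eventually_lt_const (by simpa using hab)).mono fun _ => le_of_lt

/-- The unit ball of an `n`-dimensional Euclidean space can be covered by `O(q⁻ⁿ)` balls of
radius `θ`, for any `q < θ`. -/
theorem exists_covering_closedBall {q θ : ℝ} (hq : 0 < q) (hqθ : q < θ) (hθ : θ < 1) :
    ∃ K : ℝ, 0 < K ∧ ∀ (W : Type*) [NormedAddCommGroup W] [InnerProductSpace ℝ W]
      [FiniteDimensional ℝ W], ∃ t : Finset W,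
        closedBall (0 : W) 1 ⊆ ⋃ y ∈ t, closedBall y θ ∧
        (t.card : ℝ) ≤ K * q⁻¹ ^ finrank ℝ W := by
  -- Each gap in `q < q₁ < ε < r < θ` pays for one loss: the linear factor in the dimension, the
  -- enlargement of `s` to `R`, the thickness of the slab, and the mesh of the net.
  obtain ⟨q₁, hqq₁, hq₁θ⟩ := exists_between hqθ
  obtain ⟨ε, hq₁ε, hεθ⟩ := exists_between hq₁θ
  obtain ⟨r, hεr, hrθ⟩ := exists_between hεθ
  have hq₁ : 0 < q₁ := hq.trans hqq₁
  have hε : 0 < ε := hq₁.trans hq₁ε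
  have hε1 : ε < 1 := hεθ.trans hθ
  set s := √(1 - ε ^ 2)
  have hs2 : s ^ 2 = 1 - ε ^ 2 := Real.sq_sqrt (by nlinarith)
  have hs : 0 < s := Real.sqrt_pos.2 (by nlinarith)
  -- Chosen so that `ε * s / R = q₁`: a uniform point of the ball of radius `R` then hits a given
  -- target with probability at least `K₀⁻¹ * q₁ ^ n`.
  set R := s * (ε / q₁)
  have hsR : s < R := lt_mul_of_one_lt_right hs ((one_lt_div hq₁).2 hq₁ε)
  obtain ⟨ω, hω1, hω2, hω⟩ :=
    ((exists_pos_quadratic_le (show ε ^ 2 < r ^ 2 by gcongr) (2 * ε ^ 2)).and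
      ((exists_pos_quadratic_le (show s ^ 2 < R ^ 2 by gcongr) (2 * s ^ 2)).and
        self_mem_nhdsWithin)).exists
  replace hω : 0 < ω := hω
  set K₀ : ℝ := ⌊1 / ω⌋₊ + 1
  have hK₀ : 1 ≤ K₀ := by simp [K₀]
  let σ : ℝ≥0 := ⟨θ - r, by linarith⟩
  have hσ : 0 < σ := by
    change (0 : ℝ) < θ - r
    linarith
  set A : ℝ := 1 + 2 / σ
  have hA : 1 ≤ A := by
    have : (0 : ℝ) ≤ 2 / σ := by positivity
    simp only [A]
    linarith
  have hlogA := Real.log_nonneg hA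
  obtain ⟨M, hM0, hM⟩ := exists_forall_succ_mul_pow_le (div_nonneg hq.le hq₁.le)
    ((div_lt_one hq₁).2 hqq₁)
  refine ⟨(K₀ * Real.log A + 1) * M, by positivity, fun W _ _ _ => ?_⟩
  let _ : MeasurableSpace W := borel W
  have _ : BorelSpace W := ⟨rfl⟩
  set n := finrank ℝ W
  set v := volume.real (closedBall (0 : W) 1)
  have hv : 0 < v := measureReal_unitClosedBall_pos
  have hR : 0 < R := hs.trans hsR
  set B := closedBall (0 : W) R
  have hB0 : volume B ≠ 0 := (measure_closedBall_pos volume 0 hR).ne'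
  have hprob : IsProbabilityMeasure (ProbabilityTheory.cond volume B) :=
    ProbabilityTheory.cond_isProbabilityMeasure_of_finite hB0 measure_closedBall_lt_top.ne
  set p := K₀⁻¹ * q₁ ^ n
  have hp0 : 0 < p := by positivity
  have hp1 : p ≤ 1 := mul_le_one₀ (inv_le_one_of_one_le₀ hK₀) (by positivity)
    (pow_le_one₀ hq₁.le (hq₁ε.trans hε1).le)
  obtain ⟨X, hXcard, hX1, hX⟩ := exists_finset_net_closedBall (W := W) hσ
  have hp : ∀ x ∈ X,
      p ≤ (ProbabilityTheory.cond volume B).real (closedBall x r) := by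
    intro x hx
    have hx1 := mem_closedBall_zero_iff.1 (hX1 hx)
    have h1 := measureReal_closedBall_inter_ge (by linarith) hω (hε.trans hεr).le hR.le
      hω1 hω2 hx1
    rw [measureReal_def, ProbabilityTheory.cond_apply measurableSet_closedBall, ENNReal.toReal_mul,
      ENNReal.toReal_inv, ← measureReal_def, ← measureReal_def,
      Measure.addHaar_real_closedBall' volume _ hR.le]
    rw [Measure.addHaar_real_closedBall' volume _ (by positivity)] at h1
    have h2 : (ε * s) ^ n = q₁ ^ n * R ^ n := by
      rw [← mul_pow]
      congr 1
      simp only [R]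
      field_simp
    rw [h2] at h1
    rw [inv_mul_eq_div, le_div_iff₀ (by positivity)]
    simp only [p]
    rw [mul_assoc, inv_mul_le_iff₀ (by positivity)]
    linarith
  -- Enough rounds that `(1 - p) ^ m * A ^ n < 1`, so that no point of the net is missed.
  set m := ⌊n * Real.log A / p⌋₊ + 1
  obtain ⟨t, htm, Z, -, hZ, hZcard⟩ := exists_finset_card_filter_forall_notMem_le
    (ProbabilityTheory.cond volume B) (fun x : W => measurableSet_closedBall (x := x) (ε := r))
    X hp1 hp m
  have hm : n * Real.log A < p * m := by
    have := Nat.lt_floor_add_one (n * Real.log A / p)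
    rw [div_lt_iff₀ hp0] at this
    push_cast [m]
    linarith
  have hZ0 : Z = ∅ := by
    rw [← Finset.card_eq_zero]
    have h1 : (1 - p) ^ m ≤ Real.exp (-(p * m)) := by
      rw [show -(p * m) = m * (-p) by ring, Real.exp_nat_mul]
      exact pow_le_pow_left₀ (by linarith) (Real.one_sub_le_exp_neg p) m
    have h2 : Real.exp (n * Real.log A) = A ^ n := by
      rw [Real.exp_nat_mul, Real.exp_log (by linarith)]
    have h4 : (Z.card : ℝ) < 1 := calc
      (Z.card : ℝ) ≤ Real.exp (-(p * m)) * A ^ n := hZcard.trans (by gcongr)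
      _ = Real.exp (n * Real.log A - p * m) := by rw [← h2, ← Real.exp_add]; ring_nf
      _ < 1 := Real.exp_lt_one_iff.2 (by linarith)
    exact_mod_cast Nat.lt_one_iff.1 (by exact_mod_cast h4)
  refine ⟨t, fun x hx => ?_, ?_⟩
  · obtain ⟨y, hyX, hxy⟩ := hX x hx
    obtain ⟨z, hz, hyz⟩ := hZ y hyX (by simp [hZ0])
    refine Set.mem_biUnion hz (mem_closedBall.2 ?_)
    have h1 : dist x y ≤ θ - r := hxy
    have h2 := mem_closedBall'.1 hyz
    have := dist_triangle x y z
    linarith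
  · have h1 : (t.card : ℝ) ≤ n * Real.log A / p + 1 := by
      have h2 : (t.card : ℝ) ≤ m := by exact_mod_cast htm
      have h3 := Nat.floor_le (show 0 ≤ n * Real.log A / p by positivity)
      push_cast [m] at h2
      linarith
    have h4 : n * Real.log A / p = n * (K₀ * Real.log A) * q₁⁻¹ ^ n := by
      simp only [p, inv_pow]
      field_simp
    have h5 : 1 ≤ q₁⁻¹ ^ n := one_le_pow₀ ((one_le_inv₀ hq₁).2 (hq₁ε.trans hε1).le)
    have h6 : (n + 1) * q₁⁻¹ ^ n ≤ M * q⁻¹ ^ n := by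
      have := mul_le_mul_of_nonneg_right (hM n) (show 0 ≤ q⁻¹ ^ n by positivity)
      rwa [mul_assoc, ← mul_pow, div_mul_eq_mul_div, mul_inv_cancel₀ hq.ne', one_div] at this
    have h7 : 0 ≤ K₀ * Real.log A := by positivity
    calc (t.card : ℝ) ≤ n * (K₀ * Real.log A) * q₁⁻¹ ^ n + 1 := h4 ▸ h1
      _ ≤ (K₀ * Real.log A + 1) * ((n + 1) * q₁⁻¹ ^ n) := by
          have h8 : (0 : ℝ) ≤ n := Nat.cast_nonneg n
          have h9 : 0 ≤ K₀ * Real.log A * q₁⁻¹ ^ n := by positivity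
          nlinarith [mul_nonneg h8 (show 0 ≤ q₁⁻¹ ^ n by positivity)]
      _ ≤ (K₀ * Real.log A + 1) * (M * q⁻¹ ^ n) := by gcongr
      _ = _ := by ring

end BallCovering

/-! ### Diagonalization of compact symmetric operators. -/

section Eigenbasis

open Module.End

universe u v

variable {𝕜 : Type u} {E : Type v} [RCLike 𝕜] [NormedAddCommGroup E] [InnerProductSpace 𝕜 E]
  [CompleteSpace E]

/-- A compact symmetric operator has a Hilbert basis of eigenvectors. -/
theorem IsCompactOperator.exists_hilbertBasis_eigenvectors {T : E →L[𝕜] E}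
    (hT : IsCompactOperator T) (hT' : T.IsSymmetric) :
    ∃ (ι : Type (max u v)) (b : HilbertBasis ι 𝕜 E) (μ : ι → 𝕜), ∀ i, T (b i) = μ i • b i := by
  have hclosed : ∀ μ : 𝕜, IsClosed (eigenspace (T : Module.End 𝕜 E) μ : Set E) := by
    intro μ
    have : (eigenspace (T : Module.End 𝕜 E) μ : Set E) = {x | T x = μ • x} := by
      ext x
      simp
    rw [this]
    exact isClosed_eq T.continuous (continuous_const_smul μ)
  have hcomp : ∀ μ : 𝕜, CompleteSpace (eigenspace (T : Module.End 𝕜 E) μ) := fun μ =>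
    (hclosed μ).completeSpace_coe
  choose w b hb using fun μ : 𝕜 => exists_hilbertBasis 𝕜 (eigenspace (T : Module.End 𝕜 E) μ)
  let v : (Σ μ : 𝕜, w μ) → E := fun i => (b i.1 i.2 : E)
  have hv : Orthonormal 𝕜 v :=
    hT'.orthogonalFamily_eigenspaces.orthonormal_sigma_orthonormal fun μ => (b μ).orthonormal
  have hspan : (Submodule.span 𝕜 (Set.range v))ᗮ = ⊥ := by
    rw [eq_bot_iff, ← T.orthogonalComplement_iSup_eigenspaces_eq_bot hT hT']
    intro x hx
    rw [Submodule.mem_orthogonal] at hx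
    rw [← Submodule.iInf_orthogonal, Submodule.mem_iInf]
    intro μ
    rw [Submodule.mem_orthogonal']
    intro y hy
    have h1 := ((b μ).hasSum_repr ⟨y, hy⟩).mapL
      (innerSL 𝕜 x ∘L (eigenspace (T : Module.End 𝕜 E) μ).subtypeL)
    have h2 : ∀ i, inner 𝕜 x (b μ i : E) = 0 := fun i =>
      inner_eq_zero_symm.1 (hx _ (Submodule.subset_span ⟨⟨μ, i⟩, rfl⟩))
    simp only [ContinuousLinearMap.comp_apply, map_smul, Submodule.subtypeL_apply,
      innerSL_apply_apply, h2, smul_zero] at h1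
    exact (h1.unique hasSum_zero)
  refine ⟨_, HilbertBasis.mkOfOrthogonalEqBot hv hspan, fun i => i.1, fun i => ?_⟩
  rw [HilbertBasis.coe_mkOfOrthogonalEqBot]
  exact mem_eigenspace_iff.1 (b i.1 i.2).2

end Eigenbasis

/-! ### Counting eigenvalues from the two traces. -/

section EigenvalueCount

variable {ι : Type*} {Λ : ι → ℝ} {τ κ δ : ℝ}

theorem finite_setOf_lt_of_summable (hΛ : Summable Λ) (hδ : 0 < δ) : {i | δ < Λ i}.Finite := by
  have h := hΛ.tendsto_cofinite_zero.eventually_lt_const hδ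
  exact (Filter.eventually_cofinite.1 h).subset fun i hi => not_lt.2 (le_of_lt hi)

/-- For `δ < Λ ≤ 1` one has `1 ≤ Λ + (Λ - Λ²) / δ`; sum over `s`. -/
theorem card_le_of_hasSum (h0 : ∀ i, 0 ≤ Λ i) (h1 : ∀ i, Λ i ≤ 1) (hτ : HasSum Λ τ)
    (hκ : HasSum (fun i => Λ i - Λ i ^ 2) κ) (hδ : 0 < δ) (s : Finset ι)
    (hs : ∀ i ∈ s, δ < Λ i) : (s.card : ℝ) ≤ τ + κ / δ := by
  have hsum := hτ.add (hκ.div_const δ)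
  refine le_trans ?_ (sum_le_hasSum s (fun i _ => ?_) hsum)
  · rw [← nsmul_one]
    refine Finset.card_nsmul_le_sum _ _ _ fun i hi => ?_
    have h2 : 1 - Λ i ≤ (Λ i - Λ i ^ 2) / δ := by
      rw [le_div_iff₀ hδ]
      nlinarith [hs i hi, h1 i]
    linarith
  · have : 0 ≤ (Λ i - Λ i ^ 2) / δ := div_nonneg (by nlinarith [h0 i, h1 i]) hδ.le
    have := h0 i
    positivity

/-- The function `Λ - (Λ - Λ²) / δ` is at most `1` everywhere and nonpositive where `Λ ≤ 1 - δ`, so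
the indicator of `s` dominates it. -/
theorem le_card_of_hasSum (h0 : ∀ i, 0 ≤ Λ i) (h1 : ∀ i, Λ i ≤ 1) (hτ : HasSum Λ τ)
    (hκ : HasSum (fun i => Λ i - Λ i ^ 2) κ) (hδ : 0 < δ) (s : Finset ι)
    (hs : ∀ i ∉ s, Λ i ≤ 1 - δ) : τ - κ / δ ≤ s.card := by
  have hsum := hτ.sub (hκ.div_const δ)
  have hle : ∀ i, Λ i - (Λ i - Λ i ^ 2) / δ ≤ (s : Set ι).indicator (fun _ => (1 : ℝ)) i := by
    intro i
    by_cases hi : i ∈ s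
    · have : 0 ≤ (Λ i - Λ i ^ 2) / δ := div_nonneg (by nlinarith [h0 i, h1 i]) hδ.le
      simp only [Finset.mem_coe, hi, Set.indicator_of_mem]
      linarith [h1 i]
    · have h2 : Λ i ≤ (Λ i - Λ i ^ 2) / δ := by
        rw [le_div_iff₀ hδ]
        nlinarith [hs i hi, h0 i]
      simp only [Finset.mem_coe, hi, not_false_eq_true, Set.indicator_of_notMem]
      linarith
  have hone : HasSum ((s : Set ι).indicator fun _ => (1 : ℝ)) s.card := by
    have := hasSum_sum_of_ne_finset_zero (f := (s : Set ι).indicator fun _ => (1 : ℝ)) (s := s)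
      (L := .unconditional ι) fun i hi => by simp [hi]
    convert this using 1
    rw [Finset.sum_congr rfl fun i hi => Set.indicator_of_mem (Finset.mem_coe.2 hi) _]
    simp
  exact hasSum_le hle hsum hone

end EigenvalueCount

/-! ### Covering numbers of diagonal operators. -/

section DiagonalEntropy

variable {ι H : Type*} [NormedAddCommGroup H] [InnerProductSpace ℂ H]

open Metric

/-- The coordinates of a vector along finitely many vectors of a Hilbert basis. -/
noncomputable def HilbertBasis.coords (b : HilbertBasis ι ℂ H) (s : Finset ι) (y : H) :
    EuclideanSpace ℂ s :=
  WithLp.toLp 2 fun i => inner ℂ (b i) y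

/-- The vector with given coordinates along finitely many vectors of a Hilbert basis. -/
noncomputable def HilbertBasis.ofCoords (b : HilbertBasis ι ℂ H) (s : Finset ι)
    (u : EuclideanSpace ℂ s) : H :=
  ∑ i, u i • b (i : ι)

variable (b : HilbertBasis ι ℂ H) (s : Finset ι)

theorem HilbertBasis.coords_sub (y z : H) :
    b.coords s (y - z) = b.coords s y - b.coords s z := by
  ext i
  simp [HilbertBasis.coords]

theorem HilbertBasis.ofCoords_sub (u v : EuclideanSpace ℂ s) :
    b.ofCoords s (u - v) = b.ofCoords s u - b.ofCoords s v := by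
  simp [HilbertBasis.ofCoords, sub_smul]

theorem HilbertBasis.norm_coords_le (y : H) : ‖b.coords s y‖ ≤ ‖y‖ := by
  refine le_of_sq_le_sq ?_ (norm_nonneg y)
  rw [EuclideanSpace.norm_sq_eq]
  simp only [HilbertBasis.coords]
  rw [Finset.sum_coe_sort s fun i => ‖inner ℂ (b i) y‖ ^ 2]
  exact sum_le_hasSum s (fun _ _ => by positivity) (b.hasSum_norm_inner_sq y)

theorem HilbertBasis.inner_ofCoords (u : EuclideanSpace ℂ s) (i : s) :
    inner ℂ (b i) (b.ofCoords s u) = u i :=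
  (b.orthonormal.comp _ Subtype.val_injective).inner_right_fintype u i

theorem HilbertBasis.inner_ofCoords_of_notMem (u : EuclideanSpace ℂ s) {i : ι} (hi : i ∉ s) :
    inner ℂ (b i) (b.ofCoords s u) = 0 := by
  rw [HilbertBasis.ofCoords, inner_sum]
  refine Finset.sum_eq_zero fun j _ => ?_
  rw [inner_smul_right, b.orthonormal.2 (show i ≠ j by rintro rfl; exact hi j.2), mul_zero]

theorem HilbertBasis.norm_ofCoords (u : EuclideanSpace ℂ s) : ‖b.ofCoords s u‖ = ‖u‖ := by
  refine (sq_eq_sq₀ (norm_nonneg _) (norm_nonneg _)).1 ?_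
  refine (b.hasSum_norm_inner_sq (b.ofCoords s u)).unique ?_
  rw [EuclideanSpace.norm_sq_eq]
  have h := hasSum_sum_of_ne_finset_zero (f := fun i => ‖inner ℂ (b i) (b.ofCoords s u)‖ ^ 2)
    (s := s) (L := .unconditional ι) fun i hi => by simp [b.inner_ofCoords_of_notMem s u hi]
  rw [← Finset.sum_coe_sort] at h
  simpa only [b.inner_ofCoords] using h

variable {T : H →L[ℂ] H} {Λ : ι → ℝ}

theorem inner_apply_of_forall_eigenvector (hT : (T : H →ₗ[ℂ] H).IsSymmetric)
    (hb : ∀ i, T (b i) = (Λ i : ℂ) • b i) (i : ι) (x : H) :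
    inner ℂ (b i) (T x) = Λ i * inner ℂ (b i) x := by
  have h : inner ℂ (T (b i)) x = inner ℂ (b i) (T x) := hT (b i) x
  rw [← h, hb, inner_smul_left, Complex.conj_ofReal]

/-- The coordinates of `T x` in `s` lie in a unit ball, covered with radius `θ`; the discarded ones
have total norm at most `δ`. -/
theorem externalCoveringNumber_le_of_eigenbasis (hT : (T : H →ₗ[ℂ] H).IsSymmetric)
    (hT1 : ∀ x, ‖T x‖ ≤ ‖x‖)
    (hb : ∀ i, T (b i) = (Λ i : ℂ) • b i) {δ θ : ℝ} (hδ : 0 ≤ δ) (hs : ∀ i ∉ s, |Λ i| ≤ δ)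
    (t : Finset (EuclideanSpace ℂ s))
    (ht : closedBall (0 : EuclideanSpace ℂ s) 1 ⊆ ⋃ y ∈ t, closedBall y θ) :
    externalCoveringNumber (θ + δ).toNNReal (closure (T '' closedBall 0 1)) ≤ t.card := by
  classical
  have hcov : IsCover (θ + δ).toNNReal (T '' closedBall 0 1)
      (t.image (b.ofCoords s) : Set H) := by
    rw [isCover_iff_subset_iUnion_closedBall]
    rintro _ ⟨x, hx, rfl⟩
    have hx1 := mem_closedBall_zero_iff.1 hx
    have hu : b.coords s (T x) ∈ closedBall (0 : EuclideanSpace ℂ s) 1 :=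
      mem_closedBall_zero_iff.2 ((b.norm_coords_le s _).trans ((hT1 x).trans hx1))
    obtain ⟨v, hv, huv⟩ := Set.mem_iUnion₂.1 (ht hu)
    refine Set.mem_biUnion (x := b.ofCoords s v)
      (Finset.mem_coe.2 (Finset.mem_image_of_mem _ hv)) ?_
    have h1 : ‖T x - b.ofCoords s (b.coords s (T x))‖ ≤ δ := by
      refine le_of_sq_le_sq ?_ hδ
      have h2 := (b.hasSum_norm_inner_sq x).mul_left (δ ^ 2)
      refine (hasSum_le (fun i => ?_)
        (b.hasSum_norm_inner_sq (T x - b.ofCoords s (b.coords s (T x)))) h2).trans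
        (mul_le_of_le_one_right (sq_nonneg δ) (pow_le_one₀ (norm_nonneg _) hx1))
      rw [inner_sub_right, ← mul_pow]
      gcongr
      by_cases hi : i ∈ s
      · rw [b.inner_ofCoords s _ ⟨i, hi⟩]
        simp only [HilbertBasis.coords, sub_self, norm_zero]
        positivity
      · rw [b.inner_ofCoords_of_notMem s _ hi, sub_zero,
          inner_apply_of_forall_eigenvector b hT hb, norm_mul, Complex.norm_real]
        exact mul_le_mul_of_nonneg_right (hs i hi) (norm_nonneg _)
    have h3 : ‖b.ofCoords s (b.coords s (T x)) - b.ofCoords s v‖ ≤ θ := by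
      rw [← b.ofCoords_sub, b.norm_ofCoords]
      exact mem_closedBall_iff_norm.1 huv
    rw [mem_closedBall_iff_norm]
    refine le_trans ?_ (Real.le_coe_toNNReal _)
    calc ‖T x - b.ofCoords s v‖ ≤ _ := norm_sub_le_norm_sub_add_norm_sub _ _ _
      _ ≤ δ + θ := add_le_add h1 h3
      _ = θ + δ := add_comm _ _
  have hcl : IsCover (θ + δ).toNNReal (closure (T '' closedBall 0 1))
      (t.image (b.ofCoords s) : Set H) :=
    isCover_iff_subset_iUnion_closedBall.2 (closure_minimal
      (isCover_iff_subset_iUnion_closedBall.1 hcov)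
      ((Finset.finite_toSet _).isClosed_biUnion fun _ _ => isClosed_closedBall))
  refine hcl.externalCoveringNumber_le_encard.trans ?_
  rw [Set.encard_coe_eq_coe_finsetCard]
  exact_mod_cast Finset.card_image_le

/-- The source of the factor `2` in the limit: volumes see the real dimension. -/
theorem finrank_real_euclideanSpace_complex :
    Module.finrank ℝ (EuclideanSpace ℂ s) = 2 * s.card := by
  rw [finrank_real_of_complex, finrank_euclideanSpace, Fintype.card_coe]

/-- The image contains the ball of radius `a` in the span of `s`. Taking coordinates does not
increase distances, so a cover of the image projects to a cover of that ball, and volumes can be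
compared. -/
theorem pow_le_card_mul_pow_of_eigenbasis
    (hb : ∀ i, T (b i) = (Λ i : ℂ) • b i) {a ε : ℝ} (ha : 0 < a) (hε : 0 ≤ ε)
    (hs : ∀ i ∈ s, a ≤ Λ i) (C : Finset H)
    (hC : T '' closedBall 0 1 ⊆ ⋃ y ∈ C, closedBall y ε) :
    a ^ (2 * s.card) ≤ C.card * ε ^ (2 * s.card) := by
  classical
  let _ : MeasurableSpace (EuclideanSpace ℂ s) := borel _
  have _ : BorelSpace (EuclideanSpace ℂ s) := ⟨rfl⟩
  have hsub : closedBall (0 : EuclideanSpace ℂ s) a ⊆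
      ⋃ y ∈ C.image (b.coords s), closedBall y ε := by
    intro u hu
    have hu1 := mem_closedBall_zero_iff.1 hu
    let u' : EuclideanSpace ℂ s := WithLp.toLp 2 fun i => ((Λ i : ℂ)⁻¹ * u i)
    have hΛ : ∀ i : s, 0 < Λ i := fun i => ha.trans_le (hs i i.2)
    have hu' : ‖u'‖ ≤ 1 := by
      refine le_of_sq_le_sq ?_ zero_le_one
      rw [EuclideanSpace.norm_sq_eq]
      calc ∑ i, ‖u' i‖ ^ 2 ≤ ∑ i, (a⁻¹) ^ 2 * ‖u i‖ ^ 2 := by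
            refine Finset.sum_le_sum fun i _ => ?_
            simp only [u', norm_mul, mul_pow, norm_inv, Complex.norm_real, Real.norm_eq_abs,
              abs_of_pos (hΛ i)]
            have := hΛ i
            gcongr
            exact hs i i.2
        _ = (a⁻¹ * ‖u‖) ^ 2 := by rw [← Finset.mul_sum, ← EuclideanSpace.norm_sq_eq, mul_pow]
        _ ≤ 1 ^ 2 := by
            gcongr
            rwa [inv_mul_le_one₀ ha]
    have hTu : T (b.ofCoords s u') = b.ofCoords s u := by
      simp only [HilbertBasis.ofCoords, map_sum, map_smul, hb, smul_smul]
      refine Finset.sum_congr rfl fun i _ => ?_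
      congr 1
      have : (Λ i : ℂ) ≠ 0 := by exact_mod_cast (hΛ i).ne'
      simp only [u']
      field_simp
    obtain ⟨y, hy, huy⟩ := Set.mem_iUnion₂.1
      (hC ⟨b.ofCoords s u', mem_closedBall_zero_iff.2 ((b.norm_ofCoords s u').trans_le hu'), rfl⟩)
    refine Set.mem_biUnion (x := b.coords s y) (Finset.mem_coe.2 (Finset.mem_image_of_mem _ hy)) ?_
    have h1 : b.coords s (b.ofCoords s u) = u := by
      ext i
      exact b.inner_ofCoords s u i
    rw [mem_closedBall_iff_norm, ← h1, ← b.coords_sub]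
    refine (b.norm_coords_le s _).trans ?_
    rw [← hTu]
    exact mem_closedBall_iff_norm.1 huy
  have h := pow_finrank_le_card_mul_of_closedBall_subset ha.le hε _ hsub
  rw [finrank_real_euclideanSpace_complex] at h
  refine h.trans ?_
  gcongr
  exact Finset.card_image_le

end DiagonalEntropy

/-! ### Two-sided entropy bounds in terms of the traces. -/

section EntropyBounds

open Metric

variable {ι H : Type*} [NormedAddCommGroup H] [InnerProductSpace ℂ H] {T : H →L[ℂ] H}

/-- Keeps `logb` away from the argument `0`, to which `toNat` sends both `0` and `⊤`. -/
theorem one_le_toNat_externalCoveringNumber (T : H →L[ℂ] H) {ε : ℝ≥0}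
    (h : externalCoveringNumber ε (closure (T '' closedBall 0 1)) ≠ ⊤) :
    1 ≤ (externalCoveringNumber ε (closure (T '' closedBall 0 1))).toNat := by
  rw [Nat.one_le_iff_ne_zero, Ne, ENat.toNat_eq_zero, not_or]
  refine ⟨fun h0 => ?_, h⟩
  rw [externalCoveringNumber_eq_zero, closure_empty_iff, Set.image_eq_empty] at h0
  exact (nonempty_closedBall.2 zero_le_one).ne_empty h0

theorem operatorEntropy_eq_zero_of_norm_le (hT1 : ∀ x, ‖T x‖ ≤ ‖x‖) :
    operatorEntropy 1 T = 0 := by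
  have hcov : IsCover (1 : ℝ).toNNReal (closure (T '' closedBall 0 1)) {0} := by
    rw [isCover_iff_subset_iUnion_closedBall]
    simp only [Set.mem_singleton_iff, Set.iUnion_iUnion_eq_left]
    refine closure_minimal ?_ isClosed_closedBall
    rintro _ ⟨x, hx, rfl⟩
    simpa using (hT1 x).trans (mem_closedBall_zero_iff.1 hx)
  have h1 := hcov.externalCoveringNumber_le_encard
  rw [Set.encard_singleton] at h1
  have h2 := one_le_toNat_externalCoveringNumber T
    (ne_top_of_le_ne_top ENat.one_ne_top h1)
  have h3 := ENat.toNat_le_toNat h1 ENat.one_ne_top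
  have h4 : (externalCoveringNumber (1 : ℝ).toNNReal (closure (T '' closedBall 0 1))).toNat = 1 :=
    le_antisymm (by simpa using h3) h2
  rw [operatorEntropy, metricEntropy, h4]
  simp

/-- Upper bound for the entropy of a diagonal positive contraction. -/
theorem exists_operatorEntropy_le {q ε : ℝ} (hq : 0 < q) (hqε : q < ε) (hε : ε < 1) :
    ∃ K δ : ℝ, 0 < δ ∧ ∀ {ι : Type*} {H : Type*} [NormedAddCommGroup H] [InnerProductSpace ℂ H]
      {T : H →L[ℂ] H} (b : HilbertBasis ι ℂ H) {Λ : ι → ℝ} {τ κ : ℝ},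
      (T : H →ₗ[ℂ] H).IsSymmetric → (∀ x, ‖T x‖ ≤ ‖x‖) → (∀ i, T (b i) = (Λ i : ℂ) • b i) →
      (∀ i, 0 ≤ Λ i) → (∀ i, Λ i ≤ 1) → HasSum Λ τ → HasSum (fun i => Λ i - Λ i ^ 2) κ →
      operatorEntropy ε T ≤ K + 2 * (τ + κ / δ) * Real.logb 2 q⁻¹ := by
  obtain ⟨θ, hqθ, hθε⟩ := exists_between hqε
  obtain ⟨K, hK, hcov⟩ := exists_covering_closedBall hq hqθ (hθε.trans hε)
  -- The radius `ε` is split into `θ` for the covering and `ε - θ` for the discarded eigenvalues.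
  -- Both constants depend on `q` and `ε` only, so they are uniform in `r`.
  refine ⟨Real.logb 2 K, ε - θ, by linarith,
    fun {ι H} _ _ {T} b {Λ τ κ} hT hT1 hb h0 h1 hτ hκ => ?_⟩
  have hδ : 0 < ε - θ := by linarith
  set s := (finite_setOf_lt_of_summable hτ.summable hδ).toFinset
  have hs : ∀ i, i ∈ s ↔ ε - θ < Λ i := fun i => by simp [s]
  obtain ⟨t, ht, hcard⟩ := hcov (EuclideanSpace ℂ s)
  have hle := externalCoveringNumber_le_of_eigenbasis b s hT hT1 hb hδ.le
    (fun i hi => by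
      rw [abs_of_nonneg (h0 i)]
      exact not_lt.1 ((hs i).not.1 hi)) t ht
  rw [add_sub_cancel] at hle
  have hpos := one_le_toNat_externalCoveringNumber T
    (ne_top_of_le_ne_top (ENat.natCast_ne_top _) hle)
  have hnat := ENat.toNat_le_toNat hle (ENat.natCast_ne_top _)
  rw [ENat.toNat_natCast] at hnat
  rw [finrank_real_euclideanSpace_complex] at hcard
  have hcount := card_le_of_hasSum h0 h1 hτ hκ hδ s fun i hi => (hs i).1 hi
  have hlogq : 0 ≤ Real.logb 2 q⁻¹ :=
    Real.logb_nonneg one_lt_two ((one_le_inv₀ hq).2 (hqε.trans hε).le)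
  calc operatorEntropy ε T
      ≤ Real.logb 2 (K * q⁻¹ ^ (2 * s.card)) := by
        refine Real.logb_le_logb_of_le one_lt_two (by exact_mod_cast hpos) ?_
        exact le_trans (by exact_mod_cast hnat) hcard
    _ = Real.logb 2 K + 2 * s.card * Real.logb 2 q⁻¹ := by
        rw [Real.logb_mul hK.ne' (by positivity), Real.logb_pow]
        push_cast
        rfl
    _ ≤ _ := by gcongr

/-- Lower bound for the entropy of a compact diagonal positive contraction. -/
theorem le_operatorEntropy (b : HilbertBasis ι ℂ H) {Λ : ι → ℝ} {τ κ : ℝ}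
    (hT : IsCompactOperator T) (hb : ∀ i, T (b i) = (Λ i : ℂ) • b i)
    (h0 : ∀ i, 0 ≤ Λ i) (h1 : ∀ i, Λ i ≤ 1) (hτ : HasSum Λ τ)
    (hκ : HasSum (fun i => Λ i - Λ i ^ 2) κ) {ε δ : ℝ} (hε : 0 < ε) (hδ : 0 < δ)
    (hεδ : ε ≤ 1 - δ) :
    2 * (τ - κ / δ) * Real.logb 2 ((1 - δ) / ε) ≤ operatorEntropy ε T := by
  set A := closure (T '' closedBall 0 1)
  have hA : IsCompact A := hT.isCompact_closure_image_closedBall 1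
  -- Compactness makes the covering number finite, so that `toNat` loses nothing.
  obtain ⟨N, hN, hNfin, hNcov⟩ := exists_finite_isCover_of_isCompact
    (show ε.toNNReal ≠ 0 by simpa using hε) hA
  have htop : externalCoveringNumber ε.toNNReal A ≠ ⊤ :=
    ne_top_of_le_ne_top hNfin.encard_lt_top.ne hNcov.externalCoveringNumber_le_encard
  set n := (externalCoveringNumber ε.toNNReal A).toNat
  have hn : externalCoveringNumber ε.toNNReal A = n := (ENat.natCast_toNat htop).symm
  obtain ⟨C, hC, hCn⟩ : ∃ C, IsCover ε.toNNReal A C ∧ C.encard < (n + 1 : ℕ) := by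
    have : externalCoveringNumber ε.toNNReal A < (n + 1 : ℕ) := by
      rw [hn]
      exact_mod_cast Nat.lt_succ_self n
    simpa [externalCoveringNumber, iInf_lt_iff] using this
  have hCfin : C.Finite := Set.encard_lt_top_iff.1 (hCn.trans (ENat.natCast_lt_top _))
  have hCcard : hCfin.toFinset.card ≤ n := by
    rw [hCfin.encard_eq_coe_toFinset_card] at hCn
    exact Nat.lt_succ_iff.1 (by exact_mod_cast hCn)
  have ha : 0 < 1 - δ := hε.trans_le hεδ
  set s := (finite_setOf_lt_of_summable hτ.summable ha).toFinset
  have hs : ∀ i, i ∈ s ↔ 1 - δ < Λ i := fun i => by simp [s]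
  have hsub : T '' closedBall 0 1 ⊆ ⋃ y ∈ hCfin.toFinset, closedBall y ε := by
    have := subset_closure.trans (isCover_iff_subset_iUnion_closedBall.1 hC)
    simpa [Real.coe_toNNReal _ hε.le] using this
  have hvol := pow_le_card_mul_pow_of_eigenbasis b s hb ha hε.le
    (fun i hi => ((hs i).1 hi).le) _ hsub
  have hcount := le_card_of_hasSum h0 h1 hτ hκ hδ s fun i hi => not_lt.1 ((hs i).not.1 hi)
  have hlog : 0 ≤ Real.logb 2 ((1 - δ) / ε) :=
    Real.logb_nonneg one_lt_two ((one_le_div hε).2 hεδ)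
  have hle : ((1 - δ) / ε) ^ (2 * s.card) ≤ n := by
    rw [div_pow, div_le_iff₀ (by positivity)]
    refine hvol.trans ?_
    gcongr
  calc 2 * (τ - κ / δ) * Real.logb 2 ((1 - δ) / ε)
      ≤ 2 * s.card * Real.logb 2 ((1 - δ) / ε) := by gcongr
    _ = Real.logb 2 (((1 - δ) / ε) ^ (2 * s.card)) := by
        rw [Real.logb_pow]
        push_cast
        rfl
    _ ≤ operatorEntropy ε T := Real.logb_le_logb_of_le one_lt_two (by positivity) hle

end EntropyBounds

/-! ### Spectral data and the limit for `ε < 1`. -/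

section SpaceBandLimiting

variable {d : ℕ}

local notation "𝔼" => EuclideanSpace ℝ (Fin d)

theorem lintegral_compl_bandKernel_ne_top {K S : Set 𝔼} (hK : MeasurableSet K)
    (hS : MeasurableSet S) (hKfin : volume K ≠ ∞) (hSfin : volume S ≠ ∞) :
    ∫⁻ x in Kᶜ, ∫⁻ y in K, ‖bandKernel S (y - x)‖ₑ ^ 2 ≠ ∞ := by
  have hm : Measurable fun z => ‖bandKernel S z‖ₑ ^ 2 :=
    (continuous_bandKernel hS hSfin).measurable.enorm.pow_const 2
  rw [lintegral_compl_lintegral_sub hK hm]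
  have hle : ∫⁻ z, ‖bandKernel S z‖ₑ ^ 2 * volume {y | y ∈ K ∧ y - z ∉ K} ≤
      ∫⁻ z, ‖bandKernel S z‖ₑ ^ 2 * volume K := by
    gcongr
    exact fun y hy => hy.1
  refine ne_top_of_le_ne_top ?_ hle
  rw [lintegral_mul_const _ hm, lintegral_enorm_sq_bandKernel hS hSfin]
  exact ENNReal.mul_ne_top hSfin hKfin

/-- The spectral data of `P_K Q_S P_K`: an eigenbasis, with the traces of the operator and of its
difference with its square. -/
theorem exists_eigenbasis_spaceBandLimiting {K S : Set 𝔼} (hK : MeasurableSet K)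
    (hS : MeasurableSet S) (hKfin : volume K ≠ ∞) (hSfin : volume S ≠ ∞) :
    ∃ (ι : Type) (b : HilbertBasis ι ℂ (L2Space d)) (Λ : ι → ℝ),
      (∀ i, spaceBandLimiting K S hK hS (b i) = (Λ i : ℂ) • b i) ∧ (∀ i, 0 ≤ Λ i) ∧
      (∀ i, Λ i ≤ 1) ∧ HasSum Λ (volume.real K * volume.real S) ∧
      HasSum (fun i => Λ i - Λ i ^ 2)
        (∫⁻ x in Kᶜ, ∫⁻ y in K, ‖bandKernel S (y - x)‖ₑ ^ 2).toReal := by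
  obtain ⟨ι, b, μ, hb⟩ := (isCompactOperator_spaceBandLimiting hK hS hKfin hSfin)
    |>.exists_hilbertBasis_eigenvectors (isSymmetric_spaceBandLimiting hK hS)
  have := countable_of_hilbertBasis b
  -- The eigenvalues in the form of squared norms, so that their sum is a Hilbert-Schmidt norm.
  set Λ : ι → ℝ := fun i => ‖indicatorProj S hS (𝓕 (indicatorProj K hK (b i)) : L2Space d)‖ ^ 2
  have hμ : ∀ i, μ i = Λ i := by
    intro i
    have h := inner_spaceBandLimiting_self hK hS (b i)
    rwa [hb, inner_smul_right, inner_self_eq_norm_sq_to_K, b.orthonormal.1, RCLike.ofReal_one,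
      one_pow, mul_one] at h
  have hb' : ∀ i, spaceBandLimiting K S hK hS (b i) = (Λ i : ℂ) • b i := fun i => by
    rw [hb, hμ]
  have h0 : ∀ i, 0 ≤ Λ i := fun i => sq_nonneg _
  have hnorm : ∀ i, ‖spaceBandLimiting K S hK hS (b i)‖ = Λ i := by
    intro i
    rw [hb', norm_smul, Complex.norm_real, Real.norm_eq_abs, abs_of_nonneg (h0 i),
      b.orthonormal.1, mul_one]
  refine ⟨ι, b, Λ, hb', h0, fun i => ?_, ?_, ?_⟩
  · rw [← hnorm, ← b.orthonormal.1 i]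
    exact norm_spaceBandLimiting_le hK hS (b i)
  · have h := hasSum_norm_sq_of_tsum_enorm_sq (ENNReal.mul_ne_top hKfin hSfin)
      (tsum_enorm_sq_fourier_indicatorProj b hK hKfin hS)
    rwa [ENNReal.toReal_mul] at h
  · have h := hasSum_norm_sq_of_tsum_enorm_sq
      (lintegral_compl_bandKernel_ne_top hK hS hKfin hSfin)
      (tsum_enorm_sq_compl_bandProj b hK hS hSfin)
    have heq : ∀ i, Λ i - Λ i ^ 2 =
        ‖indicatorProj Kᶜ hK.compl (bandProj S hS (indicatorProj K hK (b i)))‖ ^ 2 := by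
      intro i
      rw [← hnorm i, sub_eq_iff_eq_add', norm_sq_spaceBandLimiting_add, hnorm]
    simpa only [heq] using h

theorem ordinaryFrequencies_eq_smul (W : Set 𝔼) :
    ordinaryFrequencies W = (2 * Real.pi)⁻¹ • W := by
  ext ν
  rw [Set.mem_smul_set_iff_inv_smul_mem₀ (by positivity), inv_inv]
  rfl

theorem volume_real_ordinaryFrequencies (W : Set 𝔼) :
    volume.real (ordinaryFrequencies W) = volume.real W / (2 * Real.pi) ^ d := by
  rw [ordinaryFrequencies_eq_smul, measureReal_def, Measure.addHaar_smul,
    finrank_euclideanSpace_fin, ENNReal.toReal_mul, ENNReal.toReal_ofReal (abs_nonneg _),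
    abs_of_pos (by positivity), inv_pow, inv_mul_eq_div, measureReal_def]

/-- With `δ` (below) or `q` (above) fixed, the entropy bounds divided by `r ^ d` converge as `r →
∞`. Choosing `δ` near `0` and `q` near `ε` makes their limits close to the claimed one. -/
theorem tendsto_operatorEntropy_lpsOperator_div (hd : d ≠ 0) {Ω W : Set 𝔼}
    (hΩ : IsCompact Ω) (hW : IsCompact W) {ε : ℝ} (hε : 0 < ε) (hε1 : ε < 1) :
    Tendsto (fun r : ℝ => operatorEntropy ε (lpsOperator Ω W hΩ hW r) / r ^ d) atTop
      (𝓝 (2 * (volume.real Ω * volume.real (ordinaryFrequencies W)) * Real.logb 2 ε⁻¹)) := by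
  set S := ordinaryFrequencies W
  have hS : MeasurableSet S := measurableSet_ordinaryFrequencies hW.measurableSet
  have hSfin : volume S ≠ ∞ := by
    simp only [S, ordinaryFrequencies_eq_smul]
    exact (hW.smul _).measure_lt_top.ne
  set c := volume.real Ω * volume.real S
  set κ : ℝ → ℝ := fun r =>
    (∫⁻ x in (r • Ω)ᶜ, ∫⁻ y in r • Ω, ‖bandKernel S (y - x)‖ₑ ^ 2).toReal
  have hκ : Tendsto (fun r => κ r / r ^ d) atTop (𝓝 0) := by
    have h := (ENNReal.continuousAt_toReal ENNReal.zero_ne_top).tendsto.comp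
      (tendsto_lintegral_compl_smul_div hΩ (f := fun z => ‖bandKernel S z‖ₑ ^ 2)
        ((continuous_bandKernel hS hSfin).measurable.enorm.pow_const 2)
        (by rwa [lintegral_enorm_sq_bandKernel hS hSfin]))
    refine h.congr' ?_
    filter_upwards [eventually_gt_atTop 0] with r hr
    simp only [Function.comp_apply, ENNReal.toReal_div, κ]
    rw [ENNReal.toReal_ofReal (by positivity)]
  have hdata : ∀ r : ℝ, 0 < r → ∃ (ι : Type) (b : HilbertBasis ι ℂ (L2Space d)) (Λ : ι → ℝ),
      (∀ i, lpsOperator Ω W hΩ hW r (b i) = (Λ i : ℂ) • b i) ∧ (∀ i, 0 ≤ Λ i) ∧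
      (∀ i, Λ i ≤ 1) ∧ HasSum Λ (r ^ d * c) ∧ HasSum (fun i => Λ i - Λ i ^ 2) (κ r) := by
    intro r hr
    obtain ⟨ι, b, Λ, h1, h2, h3, h4, h5⟩ := exists_eigenbasis_spaceBandLimiting
      (hΩ.smul r).measurableSet hS (hΩ.smul r).measure_lt_top.ne hSfin
    refine ⟨ι, b, Λ, h1, h2, h3, ?_, h5⟩
    have : volume.real (r • Ω) = r ^ d * volume.real Ω := by
      rw [measureReal_def, Measure.addHaar_smul, finrank_euclideanSpace_fin, ENNReal.toReal_mul,
        ENNReal.toReal_ofReal (abs_nonneg _), abs_of_pos (by positivity), measureReal_def]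
    rwa [this, mul_assoc] at h4
  have hpow : Tendsto (fun r : ℝ => r ^ d) atTop atTop := tendsto_pow_atTop hd
  rw [tendsto_order]
  constructor
  · intro a ha
    have hcont : Tendsto (fun δ : ℝ => 2 * c * Real.logb 2 ((1 - δ) / ε)) (𝓝[>] 0)
        (𝓝 (2 * c * Real.logb 2 ((1 - 0) / ε))) := by
      refine Tendsto.mono_left ?_ nhdsWithin_le_nhds
      have hne : (1 - 0) / ε ≠ 0 := by simp [hε.ne']
      exact ((Real.continuousAt_logb hne).comp (f := fun δ : ℝ => (1 - δ) / ε)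
        (by fun_prop)).tendsto.const_mul _
    rw [sub_zero, one_div] at hcont
    obtain ⟨δ, hδa, hδ0, hδε⟩ := ((hcont.eventually_const_lt ha).and
      (Ioo_mem_nhdsGT (show 0 < 1 - ε by linarith))).exists
    have hlim : Tendsto (fun r => 2 * (c - κ r / r ^ d / δ) * Real.logb 2 ((1 - δ) / ε)) atTop
        (𝓝 (2 * (c - 0 / δ) * Real.logb 2 ((1 - δ) / ε))) :=
      ((tendsto_const_nhds.sub (hκ.div_const δ)).const_mul 2).mul_const _
    rw [zero_div, sub_zero] at hlim
    filter_upwards [hlim.eventually_const_lt hδa, eventually_gt_atTop 0] with r hr hr0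
    obtain ⟨ι, b, Λ, h1, h2, h3, h4, h5⟩ := hdata r hr0
    have hle := le_operatorEntropy b (isCompactOperator_spaceBandLimiting (hΩ.smul r).measurableSet
      hS (hΩ.smul r).measure_lt_top.ne hSfin) h1 h2 h3 h4 h5 hε hδ0 (by linarith)
    refine hr.trans_le ((le_div_iff₀ (by positivity)).2 (le_trans (le_of_eq ?_) hle))
    field_simp
  · intro a ha
    have hcont : Tendsto (fun q : ℝ => 2 * c * Real.logb 2 q⁻¹) (𝓝[<] ε)
        (𝓝 (2 * c * Real.logb 2 ε⁻¹)) := by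
      refine Tendsto.mono_left ?_ nhdsWithin_le_nhds
      exact ((Real.continuousAt_logb (inv_ne_zero hε.ne')).comp
        (continuousAt_inv₀ hε.ne')).tendsto.const_mul _
    obtain ⟨q, hqa, hq0, hqε⟩ := ((hcont.eventually_lt_const ha).and (Ioo_mem_nhdsLT hε)).exists
    obtain ⟨K, δ, hδ, hK⟩ := exists_operatorEntropy_le hq0 hqε hε1
    -- Here `d ≠ 0` is essential: the additive constant `K` disappears only because `r ^ d → ∞`.
    have hlim : Tendsto (fun r => K / r ^ d + 2 * (c + κ r / r ^ d / δ) * Real.logb 2 q⁻¹) atTop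
        (𝓝 (0 + 2 * (c + 0 / δ) * Real.logb 2 q⁻¹)) :=
      (hpow.const_div_atTop K).add
        (((tendsto_const_nhds.add (hκ.div_const δ)).const_mul 2).mul_const _)
    rw [zero_div, add_zero, zero_add] at hlim
    filter_upwards [hlim.eventually_lt_const hqa, eventually_gt_atTop 0] with r hr hr0
    obtain ⟨ι, b, Λ, h1, h2, h3, h4, h5⟩ := hdata r hr0
    have hle := hK b (isSymmetric_spaceBandLimiting (hΩ.smul r).measurableSet hS)
      (norm_spaceBandLimiting_le (hΩ.smul r).measurableSet hS) h1 h2 h3 h4 h5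
    refine lt_of_le_of_lt ((div_le_iff₀ (by positivity)).2 (le_trans hle (le_of_eq ?_))) hr
    field_simp

end SpaceBandLimiting

/-- Here `μHE[d]` is the `d`-dimensional Hausdorff measure in the normalization that agrees with
Lebesgue measure on `ℝᵈ`. -/
theorem theorem2 (d : ℕ) (hd : 1 ≤ d) (Ω W : Set (EuclideanSpace ℝ (Fin d)))
    (hΩ : IsCompact Ω) (hW : IsCompact W) :
    (∀ r : ℝ, 0 < r → IsCompactOperator (lpsOperator Ω W hΩ hW r)) ∧
    ∀ ε : ℝ, 0 < ε → ε ≤ 1 →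
      Tendsto (fun r : ℝ => operatorEntropy ε (lpsOperator Ω W hΩ hW r) / r ^ d) atTop
        (𝓝 (2 * (μHE[d] : Measure (EuclideanSpace ℝ (Fin d))).real Ω *
              (μHE[d] : Measure (EuclideanSpace ℝ (Fin d))).real W / (2 * Real.pi) ^ d *
            Real.logb 2 ε⁻¹)) := by
  rw [EuclideanSpace.euclideanHausdorffMeasure_eq_volume]
  have hSfin : volume (ordinaryFrequencies W) ≠ ∞ := by
    rw [ordinaryFrequencies_eq_smul]
    exact (hW.smul _).measure_lt_top.ne
  refine ⟨fun r _ => isCompactOperator_spaceBandLimiting _ _ (hΩ.smul r).measure_lt_top.ne hSfin,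
    fun ε hε hε1 => ?_⟩
  rcases hε1.eq_or_lt with rfl | hε1
  -- At `ε = 1` a single ball covers the image of a contraction, so the entropy vanishes, as does
  -- `logb 2 1`.
  · have h : ∀ r, operatorEntropy 1 (lpsOperator Ω W hΩ hW r) = 0 := fun r =>
      operatorEntropy_eq_zero_of_norm_le (norm_spaceBandLimiting_le _ _)
    simp [h]
  · have h := tendsto_operatorEntropy_lpsOperator_div (by omega) hΩ hW hε hε1
    rw [volume_real_ordinaryFrequencies] at h
    convert h using 2
    ring
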